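/- \textbf{Lemma.} Let $D_1,\dots,D_p$ be finitely many pairwise disjoint closed round discs, of radii $R_1,\dots,R_p>0$, embedded in the flat torus $T^2=\mathbb R^2/\mathbb Z^2$, and suppose that the billiard table $\Gamma=T^2\setminus\bigcup_i D_i$ has bounded horizon, i.e. there is a uniform bound on the lengths of the straight segments that avoid all obstacles. Let each $D_i$ be assigned an inverse temperature $\beta_i>0$. Consider the following Markov chain $\Phi$ on $\Omega=\partial\Gamma\times[0,\infty)$, with states $(r,v_\perp)$ where $r\in\partial\Gamma$ is a collision point (parametrized by arc length) and $v_\perp$ is the absolute value of the normal velocity at the collision. From the state $(r,v_\perp)$ with $r\in\partial D_i$, a tangential velocity $v_t$ is drawn from the distribution $\sqrt{\beta_i/\pi}\,e^{-\beta_i v_t^2}\,dv_t$; the particle leaves $r$ with normal velocity $v_\perp$ (pointing into $\Gamma$) and tangential velocity $v_t$, and moves with constant velocity until it hits $\partial\Gamma$ again, at a point $r'$; the new state is $(r',v_\perp')$, where $v_\perp'$ is the absolute value of the component of the velocity normal to $\partial\Gamma$ at $r'$. (If the velocity is zero, an event of probability zero, the state is left unchanged.) Let $\mathcal P((r,v_\perp),\cdot)$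 be the transition probability kernel of $\Phi$. Suppose that all temperatures are equal, $\beta_1=\dots=\beta_p=\beta$. Then the measure $\mu$ on $\Omega$ given by $$d\mu=\frac{2\beta}{|\partial\Gamma|}\,v_\perp e^{-\beta v_\perp^2}\,dv_\perp\,dr,$$ where $dr$ is arc length on $\partial\Gamma$ and $|\partial\Gamma|=\sum_i 2\pi R_i$ is its total length, is a probability measure and is invariant for the Markov chain $\Phi$, i.e. $$\int_\Omega\mathcal P\big((r,v_\perp),A\big)\,d\mu(r,v_\perp)=\mu(A)\quad\text{for every Borel set }A\subset\Omega .$$ -/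

import Mathlib

open MeasureTheory ProbabilityTheory

noncomputable section

/-- The vector of the lattice `ℤ²` in the plane `ℝ² = ℂ`; the torus `T²` is `ℝ² / ℤ²`. -/
def latticeVector (k : ℤ × ℤ) : ℂ := ⟨k.1, k.2⟩

/-- A billiard table `Γ = T² \ ⋃ Dᵢ` with finitely many pairwise disjoint (closed) round obstacles
`D₁, …, D_p` and bounded horizon, the obstacle `Dᵢ` acting as a thermostat of inverse temperature
`βᵢ > 0`. The geometry is described in the universal cover `ℂ` of the torus: the obstacle `Dᵢ` lifts
to the discs with centres `center i + k`, `k ∈ ℤ²`. -/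
structure ThermostattedBilliard (p : ℕ) where
  /-- a lift of the centre of the `i`-th obstacle -/
  center : Fin p → ℂ
  /-- the radius of the `i`-th obstacle -/
  radius : Fin p → ℝ
  /-- the inverse temperature of the `i`-th thermostat -/
  beta : Fin p → ℝ
  radius_pos : ∀ i, 0 < radius i
  beta_pos : ∀ i, 0 < beta i
  /-- all lifted obstacles are pairwise disjoint, i.e. the obstacles are embedded in the torus and
  do not intersect each other -/
  disjoint : Pairwise fun a b : Fin p × (ℤ × ℤ) =>
    Disjoint (Metric.closedBall (center a.1 + latticeVector a.2) (radius a.1))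
      (Metric.closedBall (center b.1 + latticeVector b.2) (radius b.1))
  /-- bounded horizon: the length of a straight segment that avoids the obstacles is bounded -/
  bounded_horizon : ∃ L : ℝ, ∀ x w : ℂ, ‖w‖ = 1 → ∃ t ∈ Set.Icc 0 L, ∃ a : Fin p × (ℤ × ℤ),
    x + t * w ∈ Metric.closedBall (center a.1 + latticeVector a.2) (radius a.1)

/-- The boundary `∂Γ`, the disjoint union of the `p` circles `∂Dᵢ`: the pair `(i, u)` stands for the
point of `∂Dᵢ` at which the unit normal pointing out of `Dᵢ` is `u`. -/
abbrev TableBoundary (p : ℕ) : Type := Fin p × Metric.sphere (0 : ℂ) 1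

/-- The phase space `Ω = ∂Γ × [0, ∞)` of pairs `(r, v⊥)`. -/
abbrev CollisionSpace (p : ℕ) : Type := TableBoundary p × Set.Ici (0 : ℝ)

namespace ThermostattedBilliard

variable {p : ℕ} (B : ThermostattedBilliard p)

/-- The lift of the `a.1`-th obstacle that is translated by the lattice vector `a.2`. -/
def disc (a : Fin p × (ℤ × ℤ)) : Set ℂ :=
  Metric.closedBall (B.center a.1 + latticeVector a.2) (B.radius a.1)

/-- A lift to the plane of a point of `∂Γ`. -/
def position (r : TableBoundary p) : ℂ := B.center r.1 + B.radius r.1 * (r.2 : ℂ)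

/-- The velocity after the collision: `v⊥` times the unit normal pointing into the table plus `s`
times the unit tangent vector, which is the normal rotated by a right angle. -/
def outVelocity (x : CollisionSpace p) (s : ℝ) : ℂ :=
  ((x.2 : ℝ) + s * Complex.I) * (x.1.2 : ℂ)

/-- `y` is the state at the next collision of a particle that has just collided in the state `x` and
has received the tangential velocity `s`: the particle moves with constant velocity from its
position until it hits an obstacle again, after a time `τ > 0`, and the new normal velocity is the
absolute value of the component of the velocity along the normal at the new collision point. -/
def IsNextCollision (x : CollisionSpace p) (s : ℝ) (y : CollisionSpace p) : Prop :=
  ∃ τ : ℝ, 0 < τ ∧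
    (∃ k : ℤ × ℤ, B.position x.1 + τ * outVelocity x s = B.position y.1 + latticeVector k) ∧
    (∀ t : ℝ, 0 < t → t < τ → ∀ a, B.position x.1 + t * outVelocity x s ∉ B.disc a) ∧
    (y.2 : ℝ) = |inner ℝ (outVelocity x s) (y.1.2 : ℂ)|

open Classical in
/-- The state at the next collision. (It exists unless the velocity is zero, an event of probability
zero, in which the particle is left where it is.) -/
def next (x : CollisionSpace p) (s : ℝ) : CollisionSpace p :=
  if h : ∃ y, B.IsNextCollision x s y then h.choose else x

/-- The law `√(β/π) e^{-β s²} ds` of the tangential velocity drawn from a thermostat of inverse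
temperature `β`. -/
def tangentialLaw (β : ℝ) : Measure ℝ :=
  volume.withDensity fun s => ENNReal.ofReal (√(β / Real.pi) * Real.exp (-β * s ^ 2))

/-! The next collision depends measurably on the state and the tangential velocity. -/

theorem isProbabilityMeasure_tangentialLaw {β : ℝ} (hβ : 0 < β) :
    IsProbabilityMeasure (tangentialLaw β) := by
  constructor
  rw [tangentialLaw, withDensity_apply _ MeasurableSet.univ, Measure.restrict_univ,
    ← ofReal_integral_eq_lintegral_ofReal ((integrable_exp_neg_mul_sq hβ).const_mul _)
      (Filter.Eventually.of_forall fun s => by positivity),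
    integral_const_mul, integral_gaussian, ← Real.sqrt_mul (by positivity)]
  have : β / Real.pi * (Real.pi / β) = 1 := by field_simp
  simp [this]

theorem continuous_position : Continuous B.position := by
  have h1 : Continuous fun r : TableBoundary p => B.center r.1 :=
    continuous_of_discreteTopology.comp continuous_fst
  have h2 : Continuous fun r : TableBoundary p => B.radius r.1 :=
    continuous_of_discreteTopology.comp continuous_fst
  unfold position
  fun_prop

theorem continuous_outVelocity :
    Continuous fun z : CollisionSpace p × ℝ => outVelocity z.1 z.2 := by
  unfold outVelocity
  fun_prop

/-- The times at which the straight line issuing from `x` meets an obstacle. -/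
def hitTimes (x : CollisionSpace p) (s : ℝ) : Set ℝ :=
  {t | 0 < t ∧ ∃ a, B.position x.1 + t * outVelocity x s ∈ B.disc a}

/-- The end point of the free flight, in the plane. -/
def landing (x : CollisionSpace p) (s : ℝ) : ℂ :=
  B.position x.1 + (sInf (B.hitTimes x s) : ℝ) * outVelocity x s

theorem measurableSet_hit (c : ℝ) :
    MeasurableSet {z : CollisionSpace p × ℝ | ∃ t ∈ B.hitTimes z.1 z.2, t < c} := by
  have key : ∀ (a : Fin p × (ℤ × ℤ)) (n : ℕ), IsClosed {z : CollisionSpace p × ℝ |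
      ∃ t ∈ Set.Icc (1 / ((n : ℝ) + 1)) (c - 1 / ((n : ℝ) + 1)),
        B.position z.1.1 + t * outVelocity z.1 z.2 ∈ B.disc a} := by
    intro a n
    set K := Set.Icc (1 / ((n : ℝ) + 1)) (c - 1 / ((n : ℝ) + 1))
    have hK : CompactSpace K := isCompact_iff_compactSpace.1 isCompact_Icc
    have hC : IsClosed {q : (CollisionSpace p × ℝ) × K |
        B.position q.1.1.1 + ((q.2 : ℝ) : ℂ) * outVelocity q.1.1 q.1.2 ∈ B.disc a} := by
      refine IsClosed.preimage ?_ Metric.isClosed_closedBall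
      have h1 := B.continuous_position
      have h2 := continuous_outVelocity (p := p)
      have h3 : Continuous fun q : (CollisionSpace p × ℝ) × K => outVelocity q.1.1 q.1.2 :=
        h2.comp continuous_fst
      fun_prop
    convert isClosedMap_fst_of_compactSpace _ hC using 1
    ext z
    constructor
    · rintro ⟨t, ht, h⟩
      exact ⟨(z, ⟨t, ht⟩), h, rfl⟩
    · rintro ⟨⟨z', t⟩, h, rfl⟩
      exact ⟨t.1, t.2, h⟩
  have : {z : CollisionSpace p × ℝ | ∃ t ∈ B.hitTimes z.1 z.2, t < c} =
      ⋃ a, ⋃ n : ℕ, {z : CollisionSpace p × ℝ |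
      ∃ t ∈ Set.Icc (1 / ((n : ℝ) + 1)) (c - 1 / ((n : ℝ) + 1)),
        B.position z.1.1 + t * outVelocity z.1 z.2 ∈ B.disc a} := by
    ext z
    simp only [hitTimes, Set.mem_ofPred_eq, Set.mem_iUnion]
    constructor
    · rintro ⟨t, ⟨ht, a, ha⟩, htc⟩
      obtain ⟨n, hn⟩ := exists_nat_one_div_lt (lt_min ht (sub_pos.2 htc))
      have h1 := hn.trans_le (min_le_left _ _)
      have h2 := hn.trans_le (min_le_right _ _)
      exact ⟨a, n, t, ⟨h1.le, by linarith⟩, ha⟩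
    · rintro ⟨a, n, t, ⟨h1, h2⟩, ha⟩
      have : 0 < 1 / ((n : ℝ) + 1) := by positivity
      exact ⟨t, ⟨by linarith, a, ha⟩, by linarith⟩
  rw [this]
  exact MeasurableSet.iUnion fun a => MeasurableSet.iUnion fun n => (key a n).measurableSet

theorem measurable_sInf_hitTimes :
    Measurable fun z : CollisionSpace p × ℝ => sInf (B.hitTimes z.1 z.2) := by
  have hbdd : ∀ z : CollisionSpace p × ℝ, BddBelow (B.hitTimes z.1 z.2) :=
    fun z => ⟨0, fun t ht => ht.1.le⟩
  have hne : MeasurableSet {z : CollisionSpace p × ℝ | B.hitTimes z.1 z.2 = ∅} := by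
    have : {z : CollisionSpace p × ℝ | B.hitTimes z.1 z.2 = ∅} =
        (⋃ n : ℕ, {z : CollisionSpace p × ℝ | ∃ t ∈ B.hitTimes z.1 z.2, t < n})ᶜ := by
      ext z
      simp only [Set.mem_ofPred_eq, Set.mem_compl_iff, Set.mem_iUnion, not_exists, not_and]
      constructor
      · intro h n t ht
        simp [h] at ht
      · intro h
        refine Set.eq_empty_of_forall_notMem fun t ht => ?_
        obtain ⟨n, hn⟩ := exists_nat_gt t
        exact h n t ht hn
    rw [this]
    exact (MeasurableSet.iUnion fun n : ℕ => B.measurableSet_hit n).compl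
  refine measurable_of_Iio fun c => ?_
  have : (fun z : CollisionSpace p × ℝ => sInf (B.hitTimes z.1 z.2)) ⁻¹' Set.Iio c =
      {z | ∃ t ∈ B.hitTimes z.1 z.2, t < c} ∪ {z | B.hitTimes z.1 z.2 = ∅ ∧ 0 < c} := by
    ext z
    simp only [Set.mem_preimage, Set.mem_Iio, Set.mem_union, Set.mem_ofPred_eq]
    rcases Set.eq_empty_or_nonempty (B.hitTimes z.1 z.2) with h | h
    · simp [h]
    · rw [csInf_lt_iff (hbdd z) h]
      simp [h.ne_empty]
  rw [this]
  exact (B.measurableSet_hit c).union (hne.inter (MeasurableSet.const _))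

theorem measurable_landing :
    Measurable fun z : CollisionSpace p × ℝ => B.landing z.1 z.2 := by
  have h1 := B.continuous_position.measurable
  have h2 := (continuous_outVelocity (p := p)).measurable
  have h3 := B.measurable_sInf_hitTimes
  unfold landing
  exact (h1.comp (measurable_fst.comp measurable_fst)).add
    ((Complex.measurable_ofReal.comp h3).mul h2)

/-- The free flight ends on the boundary of the lifted obstacle `a`. -/
def landsOn (a : Fin p × (ℤ × ℤ)) : Set (CollisionSpace p × ℝ) :=
  {z | 0 < sInf (B.hitTimes z.1 z.2) ∧
    ‖B.landing z.1 z.2 - (B.center a.1 + latticeVector a.2)‖ = B.radius a.1}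

/-- The unit vector in the direction of `w`. -/
def direction (w : ℂ) : Metric.sphere (0 : ℂ) 1 :=
  ⟨Complex.exp (Complex.arg w * Complex.I), by simp⟩

theorem measurable_direction : Measurable direction := by
  refine Measurable.subtype_mk ?_
  fun_prop

theorem norm_mul_direction (w : ℂ) : (‖w‖ : ℂ) * (direction w : ℂ) = w :=
  Complex.norm_mul_exp_arg_mul_I w

/-- The state at the end of a free flight that ends on the lifted obstacle `a`. -/
def landingState (a : Fin p × (ℤ × ℤ)) (z : CollisionSpace p × ℝ) : CollisionSpace p :=
  let u := direction (B.landing z.1 z.2 - (B.center a.1 + latticeVector a.2))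
  ((a.1, u), ⟨|inner ℝ (outVelocity z.1 z.2) (u : ℂ)|, Set.mem_Ici.2 (abs_nonneg _)⟩)

theorem measurable_landingState (a : Fin p × (ℤ × ℤ)) : Measurable (B.landingState a) := by
  have h2 := (continuous_outVelocity (p := p)).measurable
  have hu : Measurable fun z : CollisionSpace p × ℝ =>
      direction (B.landing z.1 z.2 - (B.center a.1 + latticeVector a.2)) :=
    measurable_direction.comp (B.measurable_landing.sub_const _)
  refine (measurable_const.prodMk hu).prodMk (Measurable.subtype_mk ?_)
  have := h2.inner (𝕜 := ℝ) (measurable_subtype_coe.comp hu)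
  exact continuous_abs.measurable.comp this

theorem measurableSet_landsOn (a : Fin p × (ℤ × ℤ)) : MeasurableSet (B.landsOn a) :=
  (measurableSet_lt measurable_const B.measurable_sInf_hitTimes).inter
    (measurableSet_eq_fun (B.measurable_landing.sub_const _).norm measurable_const)

theorem isNextCollision_iff (x : CollisionSpace p) (s : ℝ) (y : CollisionSpace p) :
    B.IsNextCollision x s y ↔ ∃ a, (x, s) ∈ B.landsOn a ∧ y = B.landingState a (x, s) := by
  have hbdd : BddBelow (B.hitTimes x s) := ⟨0, fun t ht => ht.1.le⟩
  constructor
  · rintro ⟨τ, hτ, ⟨k, hk⟩, hfree, hy⟩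
    have hr := B.radius_pos y.1.1
    have hu : ‖(y.1.2 : ℂ)‖ = 1 := by simpa using y.1.2.2
    have hdiff : B.position x.1 + τ * outVelocity x s -
        (B.center y.1.1 + latticeVector k) = B.radius y.1.1 * (y.1.2 : ℂ) := by
      rw [hk, position]; ring
    have hnorm : ‖(B.radius y.1.1 : ℂ) * (y.1.2 : ℂ)‖ = B.radius y.1.1 := by
      rw [norm_mul, hu, mul_one, Complex.norm_real, Real.norm_of_nonneg hr.le]
    have hmem : τ ∈ B.hitTimes x s := by
      refine ⟨hτ, (y.1.1, k), ?_⟩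
      rw [disc, mem_closedBall_iff_norm, hdiff, hnorm]
    have hinf : sInf (B.hitTimes x s) = τ := by
      refine IsLeast.csInf_eq ⟨hmem, fun t ht => ?_⟩
      by_contra hlt
      obtain ⟨ht0, a, ha⟩ := ht
      exact hfree t ht0 (not_le.1 hlt) a ha
    have hland : B.landing x s - (B.center y.1.1 + latticeVector k) =
        B.radius y.1.1 * (y.1.2 : ℂ) := by
      rw [landing, hinf, hdiff]
    have hdir : direction (B.landing x s - (B.center y.1.1 + latticeVector k)) = y.1.2 := by
      have h := norm_mul_direction (B.landing x s - (B.center y.1.1 + latticeVector k))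
      rw [hland, hnorm] at h
      rw [hland]
      exact Subtype.ext (mul_left_cancel₀ (Complex.ofReal_ne_zero.2 hr.ne') h)
    refine ⟨(y.1.1, k), ⟨by rw [hinf]; exact hτ, ?_⟩, ?_⟩
    · change ‖B.landing x s - (B.center y.1.1 + latticeVector k)‖ = _
      rw [hland, hnorm]
    · refine Prod.ext (Prod.ext rfl hdir.symm) (Subtype.ext ?_)
      change (y.2 : ℝ) = |inner ℝ (outVelocity x s)
        (direction (B.landing x s - (B.center y.1.1 + latticeVector k)) : ℂ)|
      rw [hdir, hy]
  · rintro ⟨a, ⟨hpos, hnorm⟩, rfl⟩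
    refine ⟨sInf (B.hitTimes x s), hpos, ⟨a.2, ?_⟩, ?_, rfl⟩
    · have h := norm_mul_direction (B.landing x s - (B.center a.1 + latticeVector a.2))
      have hnorm' : ‖B.landing x s - (B.center a.1 + latticeVector a.2)‖ = B.radius a.1 := hnorm
      rw [hnorm'] at h
      change B.landing x s = B.center a.1 + B.radius a.1 *
        (direction (B.landing x s - (B.center a.1 + latticeVector a.2)) : ℂ) + latticeVector a.2
      rw [h]; ring
    · intro t ht0 ht a' ha'
      exact notMem_of_lt_csInf ht hbdd ⟨ht0, a', ha'⟩

/-- The next collision is unique. -/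
theorem IsNextCollision.unique {x : CollisionSpace p} {s : ℝ} {y y' : CollisionSpace p}
    (h : B.IsNextCollision x s y) (h' : B.IsNextCollision x s y') : y = y' := by
  obtain ⟨a, ha, rfl⟩ := (B.isNextCollision_iff x s y).1 h
  obtain ⟨b, hb, rfl⟩ := (B.isNextCollision_iff x s y').1 h'
  have hab : a = b := by
    by_contra hne
    have h1 : B.landing x s ∈ Metric.closedBall (B.center a.1 + latticeVector a.2) (B.radius a.1) :=
      mem_closedBall_iff_norm.2 ha.2.le
    have h2 : B.landing x s ∈ Metric.closedBall (B.center b.1 + latticeVector b.2) (B.radius b.1) :=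
      mem_closedBall_iff_norm.2 hb.2.le
    exact Set.disjoint_left.1 (B.disjoint hne) h1 h2
  rw [hab]

theorem next_eq {x : CollisionSpace p} {s : ℝ} {y : CollisionSpace p}
    (h : B.IsNextCollision x s y) : B.next x s = y := by
  have hex : ∃ y, B.IsNextCollision x s y := ⟨y, h⟩
  rw [next, dif_pos hex]
  exact IsNextCollision.unique B hex.choose_spec h

theorem measurable_next :
    Measurable fun z : CollisionSpace p × ℝ => B.next z.1 z.2 := by
  intro A hA
  have : (fun z : CollisionSpace p × ℝ => B.next z.1 z.2) ⁻¹' A =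
      (⋃ a, (B.landsOn a ∩ B.landingState a ⁻¹' A)) ∪
        ((⋃ a, B.landsOn a)ᶜ ∩ Prod.fst ⁻¹' A) := by
    ext z
    simp only [Set.mem_preimage, Set.mem_union, Set.mem_iUnion, Set.mem_inter_iff,
      Set.mem_compl_iff]
    by_cases hz : ∃ a, z ∈ B.landsOn a
    · obtain ⟨a, ha⟩ := hz
      have hn : ∀ b, z ∈ B.landsOn b → B.next z.1 z.2 = B.landingState b z := fun b hb =>
        B.next_eq ((B.isNextCollision_iff z.1 z.2 _).2 ⟨b, hb, rfl⟩)
      constructor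
      · intro h
        exact Or.inl ⟨a, ha, by rwa [← hn a ha]⟩
      · rintro (⟨b, hb, h⟩ | ⟨h, -⟩)
        · rwa [hn b hb]
        · exact absurd ⟨a, ha⟩ h
    · have hno : ¬ ∃ y, B.IsNextCollision z.1 z.2 y := by
        rintro ⟨y, hy⟩
        obtain ⟨a, ha, -⟩ := (B.isNextCollision_iff z.1 z.2 y).1 hy
        exact hz ⟨a, ha⟩
      rw [next, dif_neg hno]
      constructor
      · exact fun h => Or.inr ⟨hz, h⟩
      · rintro (⟨b, hb, -⟩ | ⟨-, h⟩)
        · exact absurd ⟨b, hb⟩ hz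
        · exact h
  rw [this]
  refine MeasurableSet.union (MeasurableSet.iUnion fun a =>
    (B.measurableSet_landsOn a).inter (B.measurable_landingState a hA)) ?_
  exact (MeasurableSet.iUnion fun a => B.measurableSet_landsOn a).compl.inter (measurable_fst hA)

/-- The transition probability kernel `P((r, v⊥), ·)` of the Markov chain `Φ`: the law of the state
at the next collision when the tangential velocity is drawn from the thermostat at `r`. -/
def transitionKernel : Kernel (CollisionSpace p) (CollisionSpace p) where
  toFun x := (tangentialLaw (B.beta x.1.1)).map (B.next x)
  measurable' := by
    refine Measure.measurable_of_measurable_coe _ fun A hA => ?_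
    have hS := B.measurable_next hA
    have hm : ∀ x : CollisionSpace p, Measurable (B.next x) := fun x =>
      B.measurable_next.comp measurable_prodMk_left
    have h1 : Measurable fun q : Fin p × CollisionSpace p =>
        tangentialLaw (B.beta q.1) (Prod.mk q.2 ⁻¹'
          ((fun z : CollisionSpace p × ℝ => B.next z.1 z.2) ⁻¹' A)) := by
      refine measurable_from_prod_countable_right fun i => ?_
      have := isProbabilityMeasure_tangentialLaw (B.beta_pos i)
      exact measurable_measure_prodMk_left (ν := tangentialLaw (B.beta i)) hS
    have h2 := h1.comp ((measurable_fst.comp measurable_fst).prodMk measurable_id)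
    convert h2 using 2 with x
    rw [Measure.map_apply (hm x) hA]
    rfl

instance : IsMarkovKernel B.transitionKernel where
  isProbabilityMeasure x := by
    have := isProbabilityMeasure_tangentialLaw (B.beta_pos x.1.1)
    exact Measure.isProbabilityMeasure_map
      (B.measurable_next.comp measurable_prodMk_left).aemeasurable

/-- The arc-length measure `dr` on `∂Γ`: on each circle `∂Dᵢ`, the image of Lebesgue measure on
`[0, 2πRᵢ)` under the arc-length parametrization. -/
def arcLength : Measure (TableBoundary p) :=
  Measure.sum fun i => (volume.restrict (Set.Ico 0 (2 * Real.pi * B.radius i))).map fun r : ℝ =>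
    ((i, ⟨Complex.exp ((r / B.radius i : ℝ) * Complex.I), by
      rw [mem_sphere_zero_iff_norm, Complex.norm_exp_ofReal_mul_I]⟩) : TableBoundary p)

/-- The total length `|∂Γ|` of the boundary. -/
def perimeter : ℝ := ∑ i, 2 * Real.pi * B.radius i

/-- The measure `(2β / |∂Γ|) v⊥ e^{-β v⊥²} dv⊥ dr` on `Ω`. -/
def equilibriumMeasure (β : ℝ) : Measure (CollisionSpace p) :=
  (B.arcLength.prod ((volume : Measure ℝ).comap (Subtype.val : Set.Ici (0 : ℝ) → ℝ))).withDensity fun x =>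
    ENNReal.ofReal (2 * β / B.perimeter * (x.2 : ℝ) * Real.exp (-β * (x.2 : ℝ) ^ 2))

end ThermostattedBilliard

end

/-! Replace the data (v⊥, v_t) drawn at r by the outgoing velocity w. Rotating to the normal frame
at r, the joint law of state and tangential velocity becomes a constant times e^{-β‖w‖²} ⟨w, n(r)⟩⁺
dw dr (`lintegral_equilibriumMeasure_tangentialLaw`). Since the temperatures agree, the Gaussian
weight depends on w alone, and w is constant during a flight, so it suffices to compare fluxes at
fixed w.

Fix w ≠ 0 with direction e and let h be the coordinate across e. On each circle the measure ⟨w, n⟩⁺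
dr is ‖w‖ dh in terms of the height of the exit point, and ⟨w, n⟩⁻ dr is ‖w‖ dh in terms of the
height of the entry point (`lintegral_exit_flux`, `lintegral_entry_flux`). The flight preserves h
and joins each crossed obstacle to the next one on its line. For almost every h the line is tangent
to no obstacle; bounded horizon and local finiteness then give each crossed lift exactly one
successor and one predecessor. Summing over pairs of lifts modulo lattice translation, the flight
carries exit flux to entry flux (`tsum_setLIntegral_exit_eq_entry`, `lintegral_flux_flightNext`).

Entry flux at w is exit flux at -w, with the same normal speed. As e^{-β‖w‖²} dw is even, the
substitution w ↦ -w closes the argument (`lintegral_next_equilibriumMeasure`). The total mass is the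
perimeter times an elementary integral. -/

noncomputable section

namespace ThermostattedBilliard

section

variable {p : ℕ}

/-! ### Coordinates along and across a direction -/

/-- The coordinate of `z` in the direction of the unit vector `e`. -/
def along (e z : ℂ) : ℝ := e.re * z.re + e.im * z.im

/-- The coordinate of `z` in the direction orthogonal to the unit vector `e`. -/
def across (e z : ℂ) : ℝ := e.re * z.im - e.im * z.re

/-- The point with coordinates `t` along `e` and `h` across `e`. -/
def linePoint (e : ℂ) (h t : ℝ) : ℂ := e * (t + h * Complex.I)

theorem sq_add_sq_of_norm_eq_one {e : ℂ} (he : ‖e‖ = 1) : e.re ^ 2 + e.im ^ 2 = 1 := by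
  have h := Complex.sq_norm e
  rw [he, Complex.normSq_apply] at h
  linarith

theorem along_sq_add_across_sq {e : ℂ} (he : ‖e‖ = 1) (z : ℂ) :
    along e z ^ 2 + across e z ^ 2 = ‖z‖ ^ 2 := by
  have h := sq_add_sq_of_norm_eq_one he
  rw [Complex.sq_norm, Complex.normSq_apply, along, across]
  linear_combination (z.re ^ 2 + z.im ^ 2) * h

theorem along_add (e z w : ℂ) : along e (z + w) = along e z + along e w := by
  simp only [along, Complex.add_re, Complex.add_im]; ring

theorem across_add (e z w : ℂ) : across e (z + w) = across e z + across e w := by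
  simp only [across, Complex.add_re, Complex.add_im]; ring

theorem along_sub (e z w : ℂ) : along e (z - w) = along e z - along e w := by
  simp only [along, Complex.sub_re, Complex.sub_im]; ring

theorem across_sub (e z w : ℂ) : across e (z - w) = across e z - across e w := by
  simp only [across, Complex.sub_re, Complex.sub_im]; ring

theorem along_linePoint {e : ℂ} (he : ‖e‖ = 1) (h t : ℝ) : along e (linePoint e h t) = t := by
  have := sq_add_sq_of_norm_eq_one he
  simp [along, linePoint]
  linear_combination t * this

theorem across_linePoint {e : ℂ} (he : ‖e‖ = 1) (h t : ℝ) : across e (linePoint e h t) = h := by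
  have := sq_add_sq_of_norm_eq_one he
  simp [across, linePoint]
  linear_combination h * this

theorem linePoint_along_across {e : ℂ} (he : ‖e‖ = 1) (z : ℂ) :
    linePoint e (across e z) (along e z) = z := by
  have := sq_add_sq_of_norm_eq_one he
  apply Complex.ext <;> simp [along, across, linePoint]
  · linear_combination z.re * this
  · linear_combination z.im * this

theorem linePoint_add (e : ℂ) (h t h' t' : ℝ) :
    linePoint e h t + linePoint e h' t' = linePoint e (h + h') (t + t') := by
  simp only [linePoint]; push_cast; ring

theorem norm_linePoint {e : ℂ} (he : ‖e‖ = 1) (h t : ℝ) : ‖linePoint e h t‖ ^ 2 = t ^ 2 + h ^ 2 := by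
  rw [← along_sq_add_across_sq he, along_linePoint he, across_linePoint he]

/-- The unit normal at the point of a circle of radius `R` where a line of direction `e`, at signed
distance `h` from the centre, leaves the circle. -/
def exitNormal (e : ℂ) (R h : ℝ) : Metric.sphere (0 : ℂ) 1 :=
  direction (linePoint e h (√(R ^ 2 - h ^ 2)))

/-- The unit normal at the point of a circle of radius `R` where a line of direction `e`, at signed
distance `h` from the centre, enters the circle. -/
def entryNormal (e : ℂ) (R h : ℝ) : Metric.sphere (0 : ℂ) 1 :=
  direction (linePoint e h (-√(R ^ 2 - h ^ 2)))

theorem sq_sub_sq_pos_of_mem_Ioo {R h : ℝ} (hh : h ∈ Set.Ioo (-R) R) : 0 < R ^ 2 - h ^ 2 := by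
  have := sq_lt_sq' hh.1 hh.2
  linarith

theorem radius_mul_exitNormal {e : ℂ} (he : ‖e‖ = 1) {R h : ℝ} (hR : 0 < R)
    (hh : h ∈ Set.Ioo (-R) R) :
    (R : ℂ) * (exitNormal e R h : ℂ) = linePoint e h (√(R ^ 2 - h ^ 2)) := by
  have hn : ‖linePoint e h (√(R ^ 2 - h ^ 2))‖ = R := by
    rw [← sq_eq_sq₀ (norm_nonneg _) hR.le, norm_linePoint he,
      Real.sq_sqrt (sq_sub_sq_pos_of_mem_Ioo hh).le]
    ring
  have := norm_mul_direction (linePoint e h (√(R ^ 2 - h ^ 2)))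
  rwa [hn] at this

theorem radius_mul_entryNormal {e : ℂ} (he : ‖e‖ = 1) {R h : ℝ} (hR : 0 < R)
    (hh : h ∈ Set.Ioo (-R) R) :
    (R : ℂ) * (entryNormal e R h : ℂ) = linePoint e h (-√(R ^ 2 - h ^ 2)) := by
  have hn : ‖linePoint e h (-√(R ^ 2 - h ^ 2))‖ = R := by
    rw [← sq_eq_sq₀ (norm_nonneg _) hR.le, norm_linePoint he, neg_sq,
      Real.sq_sqrt (sq_sub_sq_pos_of_mem_Ioo hh).le]
    ring
  have := norm_mul_direction (linePoint e h (-√(R ^ 2 - h ^ 2)))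
  rwa [hn] at this

theorem exitNormal_neg (e : ℂ) (R h : ℝ) : exitNormal (-e) R (-h) = entryNormal e R h := by
  unfold exitNormal entryNormal linePoint
  congr 1
  push_cast
  rw [neg_sq]
  ring

/-! ### The flux through a circle -/

/-- The arc-length parametrization of a circle of radius `R`, as a map to its unit normals. -/
def arcNormal (R r : ℝ) : Metric.sphere (0 : ℂ) 1 :=
  ⟨Complex.exp ((r / R : ℝ) * Complex.I), by
    rw [mem_sphere_zero_iff_norm, Complex.norm_exp_ofReal_mul_I]⟩

theorem measurable_arcNormal (R : ℝ) : Measurable (arcNormal R) := by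
  refine Measurable.subtype_mk ?_
  fun_prop

/-- Both intervals are fundamental domains for translation by multiples of T. Working in `ENNReal`
avoids any measurability or integrability assumption on f. -/
theorem setLIntegral_Ico_eq_of_periodic {T : ℝ} (hT : 0 < T) {f : ℝ → ENNReal}
    (hf : Function.Periodic f T) (t : ℝ) :
    ∫⁻ r in Set.Ico 0 T, f r = ∫⁻ r in Set.Ioc t (t + T), f r := by
  rw [restrict_Ico_eq_restrict_Ioc]
  have h := (isAddFundamentalDomain_Ioc hT 0).setLIntegral_eq (isAddFundamentalDomain_Ioc hT t) f
    (by
      rintro ⟨g, n, rfl⟩ x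
      have := hf.zsmul n x
      simpa [AddSubgroup.vadd_def, add_comm] using this)
  rwa [zero_add] at h

theorem arcNormal_periodic {R : ℝ} (hR : 0 < R) :
    Function.Periodic (arcNormal R) (2 * Real.pi * R) := by
  intro r
  apply Subtype.ext
  simp only [arcNormal]
  have : (((r + 2 * Real.pi * R) / R : ℝ) : ℂ) * Complex.I =
      ((r / R : ℝ) : ℂ) * Complex.I + 2 * Real.pi * Complex.I := by
    rw [add_div, mul_div_assoc, div_self hR.ne']
    push_cast; ring
  rw [this, Complex.exp_periodic]

/-- If θ is the angle from e to the normal, the height is h = R sin θ with r = Rθ up to a shift, so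
dh = cos θ dr, while the inner product is ρ cos θ. The half circle with cos θ ≤ 0 is discarded by
`ENNReal.ofReal`. -/
theorem lintegral_exit_flux {e : ℂ} (he : ‖e‖ = 1) {R ρ : ℝ} (hR : 0 < R) (hρ : 0 ≤ ρ)
    (g : Metric.sphere (0 : ℂ) 1 → ENNReal) :
    ∫⁻ r in Set.Ico 0 (2 * Real.pi * R),
        ENNReal.ofReal (inner ℝ ((ρ : ℂ) * e) (arcNormal R r : ℂ)) * g (arcNormal R r) =
      ENNReal.ofReal ρ * ∫⁻ h in Set.Ioo (-R) R, g (exitNormal e R h) := by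
  set α := Complex.arg e
  have hα : e = Complex.exp (α * Complex.I) := by
    have := Complex.norm_mul_exp_arg_mul_I e
    rw [he, Complex.ofReal_one, one_mul] at this
    exact this.symm
  have hpt : ∀ r, (arcNormal R r : ℂ) =
      linePoint e (Real.sin (r / R - α)) (Real.cos (r / R - α)) := by
    intro r
    rw [linePoint, hα, arcNormal, Complex.ofReal_cos, Complex.ofReal_sin, ← Complex.exp_mul_I,
      ← Complex.exp_add]
    refine congrArg Complex.exp ?_
    push_cast; ring
  have hin : ∀ r, inner ℝ ((ρ : ℂ) * e) (arcNormal R r : ℂ) = ρ * Real.cos (r / R - α) := by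
    intro r
    have h1 := along_linePoint he (Real.sin (r / R - α)) (Real.cos (r / R - α))
    rw [← hpt, along] at h1
    rw [← h1, Complex.inner]
    simp
    ring
  set f : ℝ → ENNReal := fun r =>
    ENNReal.ofReal (inner ℝ ((ρ : ℂ) * e) (arcNormal R r : ℂ)) * g (arcNormal R r) with hf
  have hper : Function.Periodic f (2 * Real.pi * R) := by
    intro r
    simp only [hf, arcNormal_periodic hR r]
  have hπ := Real.pi_pos
  -- The period is started at angle -π/2 from e, so that the exit half of the circle is its first
  -- half.
  set t := α * R - Real.pi / 2 * R with ht
  set t' := α * R + Real.pi / 2 * R with ht'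
  have hmem : ∀ r, r ∈ Set.Ioo t t' ↔ r / R - α ∈ Set.Ioo (-(Real.pi / 2)) (Real.pi / 2) := by
    intro r
    have h1 : t < r ↔ -(Real.pi / 2) < r / R - α := by
      rw [lt_sub_iff_add_lt, lt_div_iff₀ hR, ht]
      constructor <;> intro h <;> linarith
    have h2 : r < t' ↔ r / R - α < Real.pi / 2 := by
      rw [sub_lt_iff_lt_add, div_lt_iff₀ hR, ht']
      constructor <;> intro h <;> linarith
    rw [Set.mem_Ioo, Set.mem_Ioo, h1, h2]
  rw [setLIntegral_Ico_eq_of_periodic (by positivity) hper t]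
  have hsub : Set.Ioo t t' ⊆ Set.Ioc t (t + 2 * Real.pi * R) := by
    intro r hr
    refine ⟨hr.1, ?_⟩
    have := hr.2
    have : 0 < Real.pi * R := by positivity
    simp only [ht, ht'] at *
    linarith
  have hzero : ∫⁻ r in Set.Ioc t (t + 2 * Real.pi * R), f r = ∫⁻ r in Set.Ioo t t', f r := by
    rw [← lintegral_indicator measurableSet_Ioc, ← lintegral_indicator measurableSet_Ioo]
    refine lintegral_congr fun r => ?_
    by_cases h1 : r ∈ Set.Ioo t t'
    · rw [Set.indicator_of_mem h1, Set.indicator_of_mem (hsub h1)]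
    · rw [Set.indicator_of_notMem h1]
      by_cases h2 : r ∈ Set.Ioc t (t + 2 * Real.pi * R)
      · rw [Set.indicator_of_mem h2]
        have h3 : t' ≤ r := by
          by_contra h
          exact h1 ⟨h2.1, not_le.1 h⟩
        -- The rest of the period has angle between π/2 and 3π/2.
        have h4 : Real.cos (r / R - α) ≤ 0 := by
          apply Real.cos_nonpos_of_pi_div_two_le_of_le
          · rw [le_sub_iff_add_le, le_div_iff₀ hR]
            linarith
          · rw [sub_le_iff_le_add, div_le_iff₀ hR]
            have := h2.2
            simp only [ht] at this
            linarith
        rw [hf]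
        simp only [hin]
        rw [ENNReal.ofReal_of_nonpos (mul_nonpos_of_nonneg_of_nonpos hρ h4), zero_mul]
      · rw [Set.indicator_of_notMem h2]
  rw [hzero]
  have hder : ∀ r ∈ Set.Ioo t t', HasDerivWithinAt (fun r => R * Real.sin (r / R - α))
      (Real.cos (r / R - α)) (Set.Ioo t t') r := by
    intro r _
    have h1 : HasDerivAt (fun r : ℝ => r / R - α) (1 / R) r :=
      ((hasDerivAt_id r).div_const R).sub_const α
    have h2 := (h1.sin.const_mul R).hasDerivWithinAt (s := Set.Ioo t t')
    have h3 : R * (Real.cos (r / R - α) * (1 / R)) = Real.cos (r / R - α) := by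
      field_simp
    rwa [h3] at h2
  have hinj : Set.InjOn (fun r => R * Real.sin (r / R - α)) (Set.Ioo t t') := by
    intro r hr r' hr' h
    have h1 := mul_left_cancel₀ hR.ne' h
    have h2 := Real.injOn_sin (Set.Ioo_subset_Icc_self ((hmem r).1 hr))
      (Set.Ioo_subset_Icc_self ((hmem r').1 hr')) h1
    have h3 : r / R = r' / R := by linarith
    exact (div_left_inj' hR.ne').1 h3
  have himg : (fun r => R * Real.sin (r / R - α)) '' Set.Ioo t t' = Set.Ioo (-R) R := by
    ext h
    constructor
    · rintro ⟨r, hr, rfl⟩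
      have hr' := (hmem r).1 hr
      have h1 : Real.sin (r / R - α) < 1 := by
        have := Real.strictMonoOn_sin (Set.Ioo_subset_Icc_self hr')
          (Set.right_mem_Icc.2 (by linarith)) hr'.2
        rwa [Real.sin_pi_div_two] at this
      have h2 : -1 < Real.sin (r / R - α) := by
        have := Real.strictMonoOn_sin (Set.left_mem_Icc.2 (by linarith))
          (Set.Ioo_subset_Icc_self hr') hr'.1
        rwa [Real.sin_neg, Real.sin_pi_div_two] at this
      constructor <;> simp only <;> nlinarith
    · rintro ⟨h1, h2⟩
      have h3 : -1 < h / R := by rw [lt_div_iff₀ hR]; linarith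
      have h4 : h / R < 1 := by rw [div_lt_iff₀ hR]; linarith
      have h5 : (Real.arcsin (h / R) + α) * R / R - α = Real.arcsin (h / R) := by
        rw [mul_div_assoc, div_self hR.ne']; ring
      refine ⟨(Real.arcsin (h / R) + α) * R, (hmem _).2 ?_, ?_⟩
      · rw [h5]
        exact ⟨Real.neg_pi_div_two_lt_arcsin.2 h3, Real.arcsin_lt_pi_div_two.2 h4⟩
      · simp only
        rw [h5, Real.sin_arcsin h3.le h4.le]
        field_simp
  rw [← himg, lintegral_image_eq_lintegral_abs_deriv_mul measurableSet_Ioo hder hinj,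
    ← lintegral_const_mul' _ _ ENNReal.ofReal_ne_top]
  refine setLIntegral_congr_fun measurableSet_Ioo fun r hr => ?_
  have hr' := (hmem r).1 hr
  have hcos := Real.cos_pos_of_mem_Ioo hr'
  have hmemR : R * Real.sin (r / R - α) ∈ Set.Ioo (-R) R := by
    rw [← himg]; exact ⟨r, hr, rfl⟩
  have hex : exitNormal e R (R * Real.sin (r / R - α)) = arcNormal R r := by
    apply Subtype.ext
    apply mul_left_cancel₀ (Complex.ofReal_ne_zero.2 hR.ne')
    rw [radius_mul_exitNormal he hR hmemR, hpt]
    have h1 : R ^ 2 - (R * Real.sin (r / R - α)) ^ 2 = (R * Real.cos (r / R - α)) ^ 2 := by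
      have := Real.sin_sq_add_cos_sq (r / R - α)
      linear_combination -R ^ 2 * this
    rw [h1, Real.sqrt_sq (by positivity)]
    simp only [linePoint]
    push_cast; ring
  simp only [hf, hin]
  rw [hex, abs_of_pos hcos, ENNReal.ofReal_mul hρ, mul_assoc]

/-- Entering in direction e is exiting in direction -e, which also reverses the sign of the height.
-/
theorem lintegral_entry_flux {e : ℂ} (he : ‖e‖ = 1) {R ρ : ℝ} (hR : 0 < R) (hρ : 0 ≤ ρ)
    (g : Metric.sphere (0 : ℂ) 1 → ENNReal) :
    ∫⁻ r in Set.Ico 0 (2 * Real.pi * R),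
        ENNReal.ofReal (-inner ℝ ((ρ : ℂ) * e) (arcNormal R r : ℂ)) * g (arcNormal R r) =
      ENNReal.ofReal ρ * ∫⁻ h in Set.Ioo (-R) R, g (entryNormal e R h) := by
  have h := lintegral_exit_flux (e := -e) (by rwa [norm_neg]) hR hρ g
  simp only [mul_neg, inner_neg_left] at h
  rw [h]
  congr 1
  rw [← lintegral_indicator measurableSet_Ioo, ← lintegral_indicator measurableSet_Ioo,
    ← lintegral_neg_eq_self]
  refine lintegral_congr fun x => ?_
  have hx : -x ∈ Set.Ioo (-R) R ↔ x ∈ Set.Ioo (-R) R := by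
    simp only [Set.mem_Ioo]
    constructor <;> rintro ⟨h1, h2⟩ <;> constructor <;> linarith
  by_cases h1 : x ∈ Set.Ioo (-R) R
  · rw [Set.indicator_of_mem h1, Set.indicator_of_mem (hx.2 h1), exitNormal_neg]
  · rw [Set.indicator_of_notMem h1, Set.indicator_of_notMem (fun h => h1 (hx.1 h))]

end

section

variable {p : ℕ} (B : ThermostattedBilliard p)

/-! ### The obstacles along a line -/

/-- The centre of a lifted obstacle. -/
def liftCenter (a : Fin p × (ℤ × ℤ)) : ℂ := B.center a.1 + latticeVector a.2

/-- The lifted obstacles whose interior meets the line of direction `e` at height `h`. -/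
def crossed (e : ℂ) (h : ℝ) : Set (Fin p × (ℤ × ℤ)) :=
  {a | h - across e (B.liftCenter a) ∈ Set.Ioo (-B.radius a.1) (B.radius a.1)}

/-- Half the length of the chord that the line at height `h` cuts out of an obstacle. -/
def halfChord (e : ℂ) (h : ℝ) (a : Fin p × (ℤ × ℤ)) : ℝ :=
  √(B.radius a.1 ^ 2 - (h - across e (B.liftCenter a)) ^ 2)

/-- The obstacle `b` is the first one after `a` on the line of direction `e` at height `h`. -/
def Followed (e : ℂ) (h : ℝ) (a b : Fin p × (ℤ × ℤ)) : Prop :=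
  a ∈ B.crossed e h ∧ b ∈ B.crossed e h ∧ along e (B.liftCenter a) < along e (B.liftCenter b) ∧
    ∀ c ∈ B.crossed e h, along e (B.liftCenter c) ≤ along e (B.liftCenter a) ∨
      along e (B.liftCenter b) ≤ along e (B.liftCenter c)

/-- The line at height `h` is tangent to no obstacle. -/
def NoGrazing (e : ℂ) (h : ℝ) : Prop :=
  ∀ a, |h - across e (B.liftCenter a)| ≠ B.radius a.1

/-- There are countably many lifts, and each has only two tangent heights. -/
theorem ae_noGrazing (e : ℂ) : ∀ᵐ h : ℝ, B.NoGrazing e h := by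
  refine ae_all_iff.2 fun a => ?_
  have hfin : {h : ℝ | |h - across e (B.liftCenter a)| = B.radius a.1}.Finite := by
    refine Set.Finite.subset (Set.toFinite {across e (B.liftCenter a) + B.radius a.1,
      across e (B.liftCenter a) - B.radius a.1}) fun h hh => ?_
    rcases eq_or_eq_neg_of_abs_eq hh with h1 | h1
    · left; linarith
    · right; simp only [Set.mem_singleton_iff]; linarith
  have := hfin.measure_zero volume
  rw [ae_iff]
  simpa using this

variable {B} {e : ℂ} {h : ℝ}

theorem linePoint_mem_disc_iff (he : ‖e‖ = 1) (t : ℝ) (a : Fin p × (ℤ × ℤ)) :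
    linePoint e h t ∈ B.disc a ↔ (t - along e (B.liftCenter a)) ^ 2 +
      (h - across e (B.liftCenter a)) ^ 2 ≤ B.radius a.1 ^ 2 := by
  change linePoint e h t ∈ Metric.closedBall (B.liftCenter a) _ ↔ _
  rw [mem_closedBall_iff_norm, ← sq_le_sq₀ (norm_nonneg _) (B.radius_pos a.1).le,
    ← along_sq_add_across_sq he, along_sub, across_sub, along_linePoint he, across_linePoint he]

theorem eq_of_mem_disc {z : ℂ} {a b : Fin p × (ℤ × ℤ)} (ha : z ∈ B.disc a) (hb : z ∈ B.disc b) :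
    a = b := by
  by_contra hne
  exact Set.disjoint_left.1 (B.disjoint hne) ha hb

theorem halfChord_pos {a : Fin p × (ℤ × ℤ)} (ha : a ∈ B.crossed e h) : 0 < B.halfChord e h a :=
  Real.sqrt_pos.2 (sq_sub_sq_pos_of_mem_Ioo ha)

theorem halfChord_sq {a : Fin p × (ℤ × ℤ)} (ha : a ∈ B.crossed e h) :
    B.halfChord e h a ^ 2 = B.radius a.1 ^ 2 - (h - across e (B.liftCenter a)) ^ 2 :=
  Real.sq_sqrt (sq_sub_sq_pos_of_mem_Ioo ha).le

theorem linePoint_mem_disc_iff_of_crossed (he : ‖e‖ = 1) {a : Fin p × (ℤ × ℤ)}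
    (ha : a ∈ B.crossed e h) (t : ℝ) :
    linePoint e h t ∈ B.disc a ↔ |t - along e (B.liftCenter a)| ≤ B.halfChord e h a := by
  rw [linePoint_mem_disc_iff he, ← sq_le_sq₀ (abs_nonneg _) (halfChord_pos ha).le, sq_abs,
    halfChord_sq ha]
  constructor <;> intro h <;> linarith

theorem NoGrazing.mem_crossed (hg : B.NoGrazing e h) (he : ‖e‖ = 1) {t : ℝ}
    {a : Fin p × (ℤ × ℤ)} (ha : linePoint e h t ∈ B.disc a) : a ∈ B.crossed e h := by
  rw [linePoint_mem_disc_iff he] at ha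
  have h1 : (h - across e (B.liftCenter a)) ^ 2 ≤ B.radius a.1 ^ 2 := by
    nlinarith [sq_nonneg (t - along e (B.liftCenter a))]
  have h2 := (abs_le_of_sq_le_sq h1 (B.radius_pos a.1).le)
  exact abs_lt.1 (lt_of_le_of_ne h2 (hg a))

/-- The midpoint of a chord lies in its disc, so two crossed lifts with the same coordinate along e
would share a point. Hence this coordinate orders the crossed lifts strictly. -/
theorem injOn_along (he : ‖e‖ = 1) :
    Set.InjOn (fun a => along e (B.liftCenter a)) (B.crossed e h) := by
  intro a ha b hb hab
  refine eq_of_mem_disc (B := B) (z := linePoint e h (along e (B.liftCenter a))) ?_ ?_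
  · rw [linePoint_mem_disc_iff_of_crossed he ha, sub_self, abs_zero]
    exact (halfChord_pos ha).le
  · simp only at hab
    rw [linePoint_mem_disc_iff_of_crossed he hb, hab, sub_self, abs_zero]
    exact (halfChord_pos hb).le

/-- Obstacles that follow each other on a line are separated by a gap. -/
theorem chord_lt_chord (he : ‖e‖ = 1) {a b : Fin p × (ℤ × ℤ)} (ha : a ∈ B.crossed e h)
    (hb : b ∈ B.crossed e h) (hab : along e (B.liftCenter a) < along e (B.liftCenter b)) :
    along e (B.liftCenter a) + B.halfChord e h a <
      along e (B.liftCenter b) - B.halfChord e h b := by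
  by_contra hlt
  rw [not_lt] at hlt
  have h1 := halfChord_pos ha
  have h2 := halfChord_pos hb
  have : a = b := by
    -- If the chords overlap, the smaller of the right end of the first chord and the midpoint of
    -- the second lies on both.
    refine eq_of_mem_disc (B := B) (z := linePoint e h (min (along e (B.liftCenter a) + B.halfChord e h a)
      (along e (B.liftCenter b)))) ?_ ?_
    · rw [linePoint_mem_disc_iff_of_crossed he ha, abs_le]
      constructor
      · have : along e (B.liftCenter a) ≤ min (along e (B.liftCenter a) + B.halfChord e h a)
          (along e (B.liftCenter b)) := le_min (by linarith) hab.le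
        linarith
      · have := min_le_left (along e (B.liftCenter a) + B.halfChord e h a)
          (along e (B.liftCenter b))
        linarith
    · rw [linePoint_mem_disc_iff_of_crossed he hb, abs_le]
      constructor
      · have : along e (B.liftCenter b) - B.halfChord e h b ≤
          min (along e (B.liftCenter a) + B.halfChord e h a) (along e (B.liftCenter b)) :=
          le_min hlt (by linarith)
        linarith
      · have := min_le_right (along e (B.liftCenter a) + B.halfChord e h a)
          (along e (B.liftCenter b))
        linarith
  exact hab.ne (by rw [this])

/-! ### Local finiteness and bounded horizon -/

theorem finite_liftCenter_norm_le (M : ℝ) :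
    {a : Fin p × (ℤ × ℤ) | ‖B.liftCenter a‖ ≤ M}.Finite := by
  set N : ℤ := ⌈M + ∑ i, ‖B.center i‖⌉
  refine Set.Finite.subset (Set.toFinite ((Set.univ : Set (Fin p)) ×ˢ
    (Set.Icc (-N) N ×ˢ Set.Icc (-N) N))) ?_
  rintro ⟨i, k, l⟩ ha
  have h1 : ‖latticeVector (k, l)‖ ≤ N := by
    have h2 : latticeVector (k, l) = B.liftCenter (i, k, l) - B.center i := by
      rw [liftCenter]; ring
    have h3 : ‖B.center i‖ ≤ ∑ i, ‖B.center i‖ :=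
      Finset.single_le_sum (f := fun i => ‖B.center i‖) (fun _ _ => norm_nonneg _)
        (Finset.mem_univ i)
    calc ‖latticeVector (k, l)‖ ≤ ‖B.liftCenter (i, k, l)‖ + ‖B.center i‖ := by
          rw [h2]; exact norm_sub_le _ _
      _ ≤ M + ∑ i, ‖B.center i‖ := add_le_add ha h3
      _ ≤ N := Int.le_ceil _
  have h4 : |(k : ℝ)| ≤ N := (Complex.abs_re_le_norm (latticeVector (k, l))).trans h1
  have h5 : |(l : ℝ)| ≤ N := (Complex.abs_im_le_norm (latticeVector (k, l))).trans h1
  exact ⟨trivial, abs_le.1 (by exact_mod_cast h4), abs_le.1 (by exact_mod_cast h5)⟩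

theorem finite_crossed_along (he : ‖e‖ = 1) (T : ℝ) :
    {a | a ∈ B.crossed e h ∧ |along e (B.liftCenter a)| ≤ T}.Finite := by
  refine (finite_liftCenter_norm_le (B := B) (T + (|h| + ∑ i, B.radius i))).subset ?_
  rintro a ⟨ha, hT⟩
  have h1 : B.radius a.1 ≤ ∑ i, B.radius i :=
    Finset.single_le_sum (f := B.radius) (fun i _ => (B.radius_pos i).le) (Finset.mem_univ a.1)
  have h2 : |across e (B.liftCenter a)| ≤ |h| + ∑ i, B.radius i := by
    have h3 := ha.1
    have h4 := ha.2
    have h5 := neg_abs_le h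
    have h6 := le_abs_self h
    rw [abs_le]
    constructor <;> linarith
  have h0 : 0 ≤ T := (abs_nonneg _).trans hT
  have h3 : 0 ≤ T + (|h| + ∑ i, B.radius i) := by
    have := abs_nonneg (across e (B.liftCenter a))
    linarith
  refine (abs_le_of_sq_le_sq' ?_ h3).2
  rw [← along_sq_add_across_sq he, ← sq_abs (along e _), ← sq_abs (across e _)]
  nlinarith [abs_nonneg (along e (B.liftCenter a)), abs_nonneg (across e (B.liftCenter a))]

/-- Bounded horizon makes the ray hit an obstacle, and without grazing a hit is a crossing. The ray
starts beyond T by more than every radius, because the centre may lie behind the point hit. -/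
theorem NoGrazing.exists_crossed_gt (hg : B.NoGrazing e h) (he : ‖e‖ = 1) (T : ℝ) :
    ∃ b ∈ B.crossed e h, T < along e (B.liftCenter b) := by
  obtain ⟨L, hL⟩ := B.bounded_horizon
  set t₀ := T + ∑ i, B.radius i + 1
  obtain ⟨t, ht, b, hb⟩ := hL (linePoint e h t₀) e he
  have h1 : linePoint e h t₀ + t * e = linePoint e h (t₀ + t) := by
    simp only [linePoint]; push_cast; ring
  rw [h1] at hb
  have hb' : linePoint e h (t₀ + t) ∈ B.disc b := hb
  have hbc := hg.mem_crossed he hb'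
  refine ⟨b, hbc, ?_⟩
  rw [linePoint_mem_disc_iff he] at hb'
  have h2 : (t₀ + t - along e (B.liftCenter b)) ^ 2 ≤ B.radius b.1 ^ 2 := by
    nlinarith [sq_nonneg (h - across e (B.liftCenter b))]
  have h3 := (abs_le_of_sq_le_sq' h2 (B.radius_pos b.1).le).2
  have h4 : B.radius b.1 ≤ ∑ i, B.radius i :=
    Finset.single_le_sum (f := B.radius) (fun i _ => (B.radius_pos i).le) (Finset.mem_univ b.1)
  have h5 := ht.1
  simp only [t₀] at *
  linarith

/-! ### Reversal of a line, successors and predecessors -/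

theorem along_neg (e z : ℂ) : along (-e) z = -along e z := by
  simp only [along, Complex.neg_re, Complex.neg_im]; ring

theorem across_neg (e z : ℂ) : across (-e) z = -across e z := by
  simp only [across, Complex.neg_re, Complex.neg_im]; ring

theorem crossed_neg (B : ThermostattedBilliard p) (e : ℂ) (h : ℝ) :
    B.crossed (-e) (-h) = B.crossed e h := by
  ext a
  simp only [crossed, across_neg, Set.mem_ofPred_eq, Set.mem_Ioo]
  constructor <;> rintro ⟨h1, h2⟩ <;> constructor <;> linarith

theorem NoGrazing.neg (hg : B.NoGrazing e h) : B.NoGrazing (-e) (-h) := by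
  intro a
  rw [across_neg, ← neg_sub_neg, abs_sub_comm, neg_neg, neg_neg]
  exact fun h1 => hg a (by rw [← h1, abs_sub_comm])

theorem followed_neg (B : ThermostattedBilliard p) (e : ℂ) (h : ℝ) (a b : Fin p × (ℤ × ℤ)) :
    B.Followed (-e) (-h) a b ↔ B.Followed e h b a := by
  simp only [Followed, crossed_neg, along_neg, neg_lt_neg_iff, neg_le_neg_iff]
  constructor
  · rintro ⟨h1, h2, h3, h4⟩
    exact ⟨h2, h1, h3, fun c hc => (h4 c hc).symm⟩
  · rintro ⟨h1, h2, h3, h4⟩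
    exact ⟨h2, h1, h3, fun c hc => (h4 c hc).symm⟩

/-- Some crossed lift c lies beyond a. Only finitely many crossed lifts have coordinate bounded by
T, so a nearest one beyond a exists; anything strictly between a and it would also satisfy the
bound. -/
theorem NoGrazing.exists_followed (hg : B.NoGrazing e h) (he : ‖e‖ = 1) {a : Fin p × (ℤ × ℤ)}
    (ha : a ∈ B.crossed e h) : ∃ b, B.Followed e h a b := by
  obtain ⟨c, hc, hac⟩ := hg.exists_crossed_gt he (along e (B.liftCenter a))
  set T := max |along e (B.liftCenter a)| |along e (B.liftCenter c)|
  set S := {d | (d ∈ B.crossed e h ∧ |along e (B.liftCenter d)| ≤ T) ∧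
    along e (B.liftCenter a) < along e (B.liftCenter d)}
  have hfin : S.Finite := (finite_crossed_along he T).subset fun d hd => hd.1
  obtain ⟨b, hb, hmin⟩ := Set.exists_min_image S (fun d => along e (B.liftCenter d)) hfin
    ⟨c, ⟨hc, le_max_right _ _⟩, hac⟩
  refine ⟨b, ha, hb.1.1, hb.2, fun d hd => ?_⟩
  by_contra! hlt
  refine absurd (hmin d ⟨⟨hd, ?_⟩, hlt.1⟩) (not_le.2 hlt.2)
  have h1 := abs_le.1 hb.1.2
  have h2 : -T ≤ along e (B.liftCenter a) :=
    (neg_le_neg (le_max_left _ _)).trans (neg_abs_le _)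
  exact abs_le.2 ⟨h2.trans hlt.1.le, hlt.2.le.trans h1.2⟩

theorem NoGrazing.exists_follows (hg : B.NoGrazing e h) (he : ‖e‖ = 1) {b : Fin p × (ℤ × ℤ)}
    (hb : b ∈ B.crossed e h) : ∃ a, B.Followed e h a b := by
  obtain ⟨a, ha⟩ := hg.neg.exists_followed (by rwa [norm_neg])
    (a := b) (by rwa [crossed_neg])
  exact ⟨a, (followed_neg B e h b a).1 ha⟩

theorem Followed.right_unique (he : ‖e‖ = 1) {a b b' : Fin p × (ℤ × ℤ)}
    (hb : B.Followed e h a b) (hb' : B.Followed e h a b') : b = b' := by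
  refine injOn_along he hb.2.1 hb'.2.1 (le_antisymm ?_ ?_)
  · exact (hb.2.2.2 b' hb'.2.1).resolve_left (not_le.2 hb'.2.2.1)
  · exact (hb'.2.2.2 b hb.2.1).resolve_left (not_le.2 hb.2.2.1)

theorem Followed.left_unique (he : ‖e‖ = 1) {a a' b : Fin p × (ℤ × ℤ)}
    (ha : B.Followed e h a b) (ha' : B.Followed e h a' b) : a = a' :=
  Followed.right_unique (by rwa [norm_neg]) ((followed_neg B e h b a).2 ha)
    ((followed_neg B e h b a').2 ha')

/-- Between an obstacle and the one that follows it, the line avoids all obstacles. -/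
theorem Followed.notMem_disc (hg : B.NoGrazing e h) (he : ‖e‖ = 1) {a b : Fin p × (ℤ × ℤ)}
    (hab : B.Followed e h a b) {t : ℝ} (h1 : along e (B.liftCenter a) + B.halfChord e h a < t)
    (h2 : t < along e (B.liftCenter b) - B.halfChord e h b) (c : Fin p × (ℤ × ℤ)) :
    linePoint e h t ∉ B.disc c := by
  intro hc
  have hcc := hg.mem_crossed he hc
  rw [linePoint_mem_disc_iff_of_crossed he hcc, abs_le] at hc
  have ha := hab.1
  have hb := hab.2.1
  have pa := halfChord_pos ha
  have pb := halfChord_pos hb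
  rcases hab.2.2.2 c hcc with h3 | h3
  · rcases h3.lt_or_eq with h4 | h4
    · have := chord_lt_chord he hcc ha h4
      linarith
    · rw [injOn_along he hcc ha h4] at hc
      linarith
  · rcases h3.lt_or_eq with h4 | h4
    · have := chord_lt_chord he hb hcc h4
      linarith
    · rw [← injOn_along he hb hcc h4] at hc
      linarith

end

section

variable {p : ℕ} {B : ThermostattedBilliard p} {e : ℂ} {h : ℝ}

/-! ### The flight from one obstacle to the next -/

/-- The collision state at `r` of a particle of velocity `w`, before or after the collision. -/
def flightState (r : TableBoundary p) (w : ℂ) : CollisionSpace p :=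
  (r, ⟨|inner ℝ w (r.2 : ℂ)|, Set.mem_Ici.2 (abs_nonneg _)⟩)

theorem measurable_flightState :
    Measurable fun q : TableBoundary p × ℂ => flightState q.1 q.2 := by
  refine measurable_fst.prodMk (Measurable.subtype_mk ?_)
  have h1 : Measurable fun q : TableBoundary p × ℂ => (q.1.2 : ℂ) :=
    measurable_subtype_coe.comp (measurable_snd.comp measurable_fst)
  exact continuous_abs.measurable.comp (measurable_snd.inner (𝕜 := ℝ) h1)

theorem inner_eq_along (w u : ℂ) : inner ℝ w u = along u w := by
  rw [Complex.inner, along]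
  simp

/-- The sign condition is needed because `flightState` keeps only the absolute value of the normal
component. -/
theorem outVelocity_flightState {r : TableBoundary p} {w : ℂ} (hw : 0 ≤ inner ℝ w (r.2 : ℂ)) :
    outVelocity (flightState r w) (across r.2 w) = w := by
  have hu : ‖(r.2 : ℂ)‖ = 1 := by simp
  have := linePoint_along_across hu w
  rw [linePoint, mul_comm, ← inner_eq_along] at this
  simp only [outVelocity, flightState]
  rwa [abs_of_nonneg hw]

theorem liftCenter_zero (i : Fin p) : B.liftCenter (i, 0) = B.center i := by
  have : latticeVector 0 = 0 := by apply Complex.ext <;> simp [latticeVector]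
  simp [liftCenter, this]

theorem inner_exitNormal_nonneg (he : ‖e‖ = 1) {R ρ : ℝ} (hR : 0 < R) (hρ : 0 ≤ ρ)
    (hh : h ∈ Set.Ioo (-R) R) : 0 ≤ inner ℝ ((ρ : ℂ) * e) (exitNormal e R h : ℂ) := by
  have h1 : along e ((R : ℂ) * (exitNormal e R h : ℂ)) = √(R ^ 2 - h ^ 2) := by
    rw [radius_mul_exitNormal he hR hh, along_linePoint he]
  have h2 : along e ((R : ℂ) * (exitNormal e R h : ℂ)) =
      R * along e (exitNormal e R h : ℂ) := by
    simp [along]; ring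
  have h3 : 0 ≤ along e (exitNormal e R h : ℂ) := by
    have : 0 ≤ R * along e (exitNormal e R h : ℂ) := by
      rw [← h2, h1]; positivity
    exact nonneg_of_mul_nonneg_right this hR
  have h4 : inner ℝ ((ρ : ℂ) * e) (exitNormal e R h : ℂ) =
      ρ * along e (exitNormal e R h : ℂ) := by
    rw [inner_eq_along]; simp [along]; ring
  rw [h4]
  positivity

theorem liftCenter_eq_linePoint (he : ‖e‖ = 1) (a : Fin p × (ℤ × ℤ)) (t : ℝ) :
    B.liftCenter a + linePoint e (h - across e (B.liftCenter a)) t =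
      linePoint e h (along e (B.liftCenter a) + t) := by
  conv_lhs => rw [← linePoint_along_across he (B.liftCenter a)]
  rw [linePoint_add, across_linePoint he, add_sub_cancel]

/-- The flight runs at speed ρ along the line at height h, from the right end x₀ of the chord of the
starting lift to the left end x₁ of the chord of its successor. The starting lift is (i, 0) because
`position` uses that lift. -/
theorem next_exit (hg : B.NoGrazing e h) (he : ‖e‖ = 1) {ρ : ℝ} (hρ : 0 < ρ) {i : Fin p}
    {b : Fin p × (ℤ × ℤ)} (hab : B.Followed e h (i, 0) b) {x : CollisionSpace p} {s : ℝ}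
    (hx : x.1 = (i, exitNormal e (B.radius i) (h - across e (B.center i))))
    (hv : outVelocity x s = ρ * e) :
    B.next x s = flightState
      (b.1, entryNormal e (B.radius b.1) (h - across e (B.liftCenter b))) (ρ * e) := by
  have ha := hab.1
  have hb := hab.2.1
  have hgap := chord_lt_chord he ha hb hab.2.2.1
  set x₀ := along e (B.liftCenter (i, 0)) + B.halfChord e h (i, 0) with hx₀
  set x₁ := along e (B.liftCenter b) - B.halfChord e h b with hx₁
  have hpos : B.position x.1 = linePoint e h x₀ := by
    rw [hx, position, radius_mul_exitNormal he (B.radius_pos i) (by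
      have := ha; rwa [crossed, Set.mem_ofPred_eq, liftCenter_zero] at this)]
    rw [← liftCenter_zero i, liftCenter_eq_linePoint he]
    rfl
  have hline : ∀ t : ℝ, B.position x.1 + t * outVelocity x s = linePoint e h (x₀ + t * ρ) := by
    intro t
    rw [hpos, hv]
    simp only [linePoint]; push_cast; ring
  have hτ : x₀ + (x₁ - x₀) / ρ * ρ = x₁ := by
    rw [div_mul_cancel₀ _ hρ.ne']; ring
  refine B.next_eq ⟨(x₁ - x₀) / ρ, div_pos (by linarith) hρ, ⟨b.2, ?_⟩, ?_, ?_⟩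
  · rw [hline, hτ]
    change _ = B.center b.1 + (B.radius b.1 : ℂ) * (entryNormal e (B.radius b.1)
      (h - across e (B.liftCenter b)) : ℂ) + latticeVector b.2
    rw [radius_mul_entryNormal he (B.radius_pos b.1) hb, add_right_comm]
    change _ = B.liftCenter b + _
    rw [liftCenter_eq_linePoint he]
    rfl
  · intro t ht0 ht c
    rw [hline]
    rw [lt_div_iff₀ hρ] at ht
    have := mul_pos ht0 hρ
    exact hab.notMem_disc hg he (by linarith) (by linarith) c
  · rw [hv]; rfl

/-! ### Invariance of the flux at a fixed velocity -/

theorem lintegral_arcLength {F : TableBoundary p → ENNReal} (hF : Measurable F) :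
    ∫⁻ r, F r ∂B.arcLength = ∑' i, ∫⁻ t in Set.Ico 0 (2 * Real.pi * B.radius i),
      F (i, arcNormal (B.radius i) t) := by
  rw [arcLength, lintegral_sum_measure]
  refine tsum_congr fun i => ?_
  exact lintegral_map hF (measurable_const.prodMk (measurable_arcNormal _))

theorem measurableSet_crossed (a : Fin p × (ℤ × ℤ)) : MeasurableSet {h | a ∈ B.crossed e h} :=
  (measurable_id.sub_const _) measurableSet_Ioo

/-- The height enters only through membership in `crossed`, and the quantifier over lifts is
countable. -/
theorem measurableSet_followed (a b : Fin p × (ℤ × ℤ)) :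
    MeasurableSet {h | B.Followed e h a b} := by
  have hc := fun c => measurableSet_crossed (B := B) (e := e) c
  refine (hc a).inter ((hc b).inter ((MeasurableSet.const _).inter ?_))
  have : {h | ∀ c ∈ B.crossed e h, along e (B.liftCenter c) ≤ along e (B.liftCenter a) ∨
      along e (B.liftCenter b) ≤ along e (B.liftCenter c)} =
      ⋂ c, ({h | c ∈ B.crossed e h}ᶜ ∪ {_h | along e (B.liftCenter c) ≤ along e (B.liftCenter a) ∨
      along e (B.liftCenter b) ≤ along e (B.liftCenter c)}) := by
    ext h
    simp only [Set.mem_ofPred_eq, Set.mem_iInter, Set.mem_union, Set.mem_compl_iff]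
    exact forall_congr' fun c => imp_iff_not_or
  change MeasurableSet {h | ∀ c ∈ B.crossed e h, along e (B.liftCenter c) ≤
    along e (B.liftCenter a) ∨ along e (B.liftCenter b) ≤ along e (B.liftCenter c)}
  rw [this]
  exact MeasurableSet.iInter fun c => (hc c).compl.union (MeasurableSet.const _)

/-! ### Lattice translations -/

theorem latticeVector_add (k l : ℤ × ℤ) :
    latticeVector (k + l) = latticeVector k + latticeVector l := by
  apply Complex.ext <;> simp [latticeVector]

theorem liftCenter_add (i : Fin p) (k l : ℤ × ℤ) :
    B.liftCenter (i, k + l) = B.liftCenter (i, k) + latticeVector l := by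
  simp only [liftCenter, latticeVector_add]; ring

theorem crossed_translate (i : Fin p) (k l : ℤ × ℤ) :
    (i, k + l) ∈ B.crossed e (h + across e (latticeVector l)) ↔ (i, k) ∈ B.crossed e h := by
  simp only [crossed, Set.mem_ofPred_eq, liftCenter_add, across_add, add_sub_add_right_eq_sub]

theorem followed_translate (i j : Fin p) (k k' l : ℤ × ℤ) :
    B.Followed e (h + across e (latticeVector l)) (i, k + l) (j, k' + l) ↔
      B.Followed e h (i, k) (j, k') := by
  have hall : ∀ q : Fin p × (ℤ × ℤ) → Prop, (∀ c, q c) ↔ ∀ i k, q (i, k + l) := by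
    intro q
    refine ⟨fun hq i k => hq _, fun hq c => ?_⟩
    have := hq c.1 (c.2 - l)
    rwa [sub_add_cancel] at this
  rw [Followed, Followed, hall]
  simp only [crossed_translate, liftCenter_add, along_add, add_lt_add_iff_right,
    add_le_add_iff_right, Prod.forall]

/-! ### Decomposition of the flux by pairs of consecutive obstacles -/

theorem setLIntegral_Ioo_eq_lintegral_crossed (a : Fin p × (ℤ × ℤ)) (g : ℝ → ENNReal) :
    ∫⁻ h in Set.Ioo (-B.radius a.1) (B.radius a.1), g h =
      ∫⁻ h, {h | a ∈ B.crossed e h}.indicator (fun h => g (h - across e (B.liftCenter a))) h := by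
  rw [← lintegral_indicator measurableSet_Ioo,
    ← lintegral_sub_right_eq_self _ (across e (B.liftCenter a))]
  rfl

/-- For almost every height at which (i, 0) is crossed, exactly one term of the sum survives, that
of the unique successor. -/
theorem setLIntegral_exit (he : ‖e‖ = 1) (i : Fin p) {g : ℝ → ENNReal}
    {E : Fin p × (ℤ × ℤ) → ℝ → ENNReal}
    (hgE : ∀ h b, B.NoGrazing e h → B.Followed e h (i, 0) b →
      g (h - across e (B.center i)) = E b (h - across e (B.liftCenter b))) :
    ∫⁻ h in Set.Ioo (-B.radius i) (B.radius i), g h =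
      ∫⁻ h, ∑' b, {h | B.Followed e h (i, 0) b}.indicator
        (fun h => E b (h - across e (B.liftCenter b))) h := by
  rw [setLIntegral_Ioo_eq_lintegral_crossed (B := B) (e := e) (i, 0)]
  refine lintegral_congr_ae ?_
  filter_upwards [B.ae_noGrazing e] with h hg
  by_cases hi : (i, 0) ∈ B.crossed e h
  · obtain ⟨b, hb⟩ := hg.exists_followed he hi
    rw [Set.indicator_of_mem (by exact hi), tsum_eq_single b, Set.indicator_of_mem (by exact hb),
      liftCenter_zero, hgE h b hg hb]
    intro b' hne
    exact Set.indicator_of_notMem (s := {h | B.Followed e h (i, 0) b'})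
      (fun hb' => hne (Followed.right_unique he hb' hb)) _
  · rw [Set.indicator_of_notMem (by exact hi)]
    symm
    rw [ENNReal.tsum_eq_zero]
    exact fun b => Set.indicator_of_notMem (s := {h | B.Followed e h (i, 0) b})
      (fun hb => hi hb.1) _

theorem setLIntegral_entry (he : ‖e‖ = 1) (j : Fin p) (E : ℝ → ENNReal) :
    ∫⁻ h in Set.Ioo (-B.radius j) (B.radius j), E h =
      ∫⁻ h, ∑' a, {h | B.Followed e h a (j, 0)}.indicator
        (fun h => E (h - across e (B.liftCenter (j, 0)))) h := by
  rw [setLIntegral_Ioo_eq_lintegral_crossed (B := B) (e := e) (j, 0)]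
  refine lintegral_congr_ae ?_
  filter_upwards [B.ae_noGrazing e] with h hg
  by_cases hj : (j, 0) ∈ B.crossed e h
  · obtain ⟨a, ha⟩ := hg.exists_follows he hj
    rw [Set.indicator_of_mem (by exact hj), tsum_eq_single a, Set.indicator_of_mem (by exact ha)]
    intro a' hne
    exact Set.indicator_of_notMem (s := {h | B.Followed e h a' (j, 0)})
      (fun ha' => hne (Followed.left_unique he ha' ha)) _
  · rw [Set.indicator_of_notMem (by exact hj)]
    symm
    rw [ENNReal.tsum_eq_zero]
    exact fun a => Set.indicator_of_notMem (s := {h | B.Followed e h a (j, 0)})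
      (fun ha => hj ha.2.1) _

/-- Shifting by -k moves the arrival lift to (j, 0), so flux sorted by departure can be compared
with flux sorted by arrival. -/
theorem lintegral_followed_translate (i j : Fin p) (k : ℤ × ℤ) (E : ℝ → ENNReal) :
    ∫⁻ h, {h | B.Followed e h (i, 0) (j, k)}.indicator
        (fun h => E (h - across e (B.liftCenter (j, k)))) h =
      ∫⁻ h, {h | B.Followed e h (i, -k) (j, 0)}.indicator
        (fun h => E (h - across e (B.liftCenter (j, 0)))) h := by
  rw [← lintegral_add_right_eq_self _ (across e (latticeVector k))]
  refine lintegral_congr fun h => ?_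
  have h1 := followed_translate (B := B) (e := e) (h := h) i j (-k) 0 k
  rw [neg_add_cancel, zero_add] at h1
  have h2 : h + across e (latticeVector k) - across e (B.liftCenter (j, k)) =
      h - across e (B.liftCenter (j, 0)) := by
    have := liftCenter_add (B := B) j 0 k
    rw [zero_add] at this
    rw [this, across_add]; ring
  classical
  simp only [Set.indicator_apply, Set.mem_ofPred_eq, h1, h2]

/-- At a fixed velocity, the flux leaving the obstacles is carried by the free flight to the flux
entering the obstacles. -/
theorem tsum_setLIntegral_exit_eq_entry (he : ‖e‖ = 1) {g E : Fin p → ℝ → ENNReal}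
    (hE : ∀ j, Measurable (E j))
    (hgE : ∀ i h b, B.NoGrazing e h → B.Followed e h (i, 0) b →
      g i (h - across e (B.center i)) = E b.1 (h - across e (B.liftCenter b))) :
    ∑' i, ∫⁻ h in Set.Ioo (-B.radius i) (B.radius i), g i h =
      ∑' j, ∫⁻ h in Set.Ioo (-B.radius j) (B.radius j), E j h := by
  have hmeas : ∀ a b : Fin p × (ℤ × ℤ), Measurable
      ({h | B.Followed e h a b}.indicator fun h => E b.1 (h - across e (B.liftCenter b))) :=
    fun a b => ((hE b.1).comp (measurable_id.sub_const _)).indicator (measurableSet_followed a b)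
  -- The part of the flux arriving at (j, 0) that comes directly from (i, k).
  set T : Fin p → ℤ × ℤ → Fin p → ENNReal := fun i k j =>
    ∫⁻ h, {h | B.Followed e h (i, k) (j, 0)}.indicator
      (fun h => E j (h - across e (B.liftCenter (j, 0)))) h
  calc ∑' i, ∫⁻ h in Set.Ioo (-B.radius i) (B.radius i), g i h
      = ∑' i, ∑' j, ∑' k, T i (-k) j := by
        refine tsum_congr fun i => ?_
        rw [setLIntegral_exit he i (E := fun b => E b.1) (hgE i),
          lintegral_tsum fun b => (hmeas _ b).aemeasurable, ENNReal.tsum_prod']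
        exact tsum_congr fun j => tsum_congr fun k => lintegral_followed_translate i j k (E j)
    _ = ∑' j, ∑' i, ∑' k, T i k j := by
        rw [ENNReal.tsum_comm]
        refine tsum_congr fun j => tsum_congr fun i => ?_
        exact (Equiv.neg (ℤ × ℤ)).tsum_eq fun k => T i k j
    _ = ∑' j, ∫⁻ h in Set.Ioo (-B.radius j) (B.radius j), E j h := by
        refine tsum_congr fun j => ?_
        rw [setLIntegral_entry he j, lintegral_tsum fun a => (hmeas a (j, 0)).aemeasurable,
          ENNReal.tsum_prod']

theorem measurable_entryNormal (e : ℂ) (R : ℝ) : Measurable (entryNormal e R) := by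
  refine measurable_direction.comp ?_
  unfold linePoint
  fun_prop

theorem measurable_inner_normal :
    Measurable fun q : TableBoundary p × ℂ => inner ℝ q.2 (q.1.2 : ℂ) :=
  measurable_snd.inner (𝕜 := ℝ)
    (measurable_subtype_coe.comp (measurable_snd.comp measurable_fst))

theorem measurable_across_normal :
    Measurable fun q : TableBoundary p × ℂ => across q.1.2 q.2 := by
  have h1 : Measurable fun q : TableBoundary p × ℂ => (q.1.2 : ℂ) :=
    measurable_subtype_coe.comp (measurable_snd.comp measurable_fst)
  unfold across
  exact ((Complex.measurable_re.comp h1).mul (Complex.measurable_im.comp measurable_snd)).sub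
    ((Complex.measurable_im.comp h1).mul (Complex.measurable_re.comp measurable_snd))

/-- The state after the free flight of a particle that leaves `r` with velocity `w`. -/
def flightNext (B : ThermostattedBilliard p) (r : TableBoundary p) (w : ℂ) : CollisionSpace p :=
  B.next (flightState r w) (across r.2 w)

theorem measurable_flightNext (B : ThermostattedBilliard p) :
    Measurable fun q : TableBoundary p × ℂ => B.flightNext q.1 q.2 :=
  B.measurable_next.comp (measurable_flightState.prodMk measurable_across_normal)

/-- Both sides become ‖w‖ times a sum of integrals over heights; by `next_exit` the integrand at an
exit equals that at the following entry. -/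
theorem lintegral_flux_flightNext {f : CollisionSpace p → ENNReal} (hf : Measurable f) {w : ℂ}
    (hw : w ≠ 0) :
    ∫⁻ r, ENNReal.ofReal (inner ℝ w (r.2 : ℂ)) * f (B.flightNext r w) ∂B.arcLength =
      ∫⁻ r, ENNReal.ofReal (-inner ℝ w (r.2 : ℂ)) * f (flightState r w) ∂B.arcLength := by
  have hin : Measurable fun r : TableBoundary p => inner ℝ w (r.2 : ℂ) :=
    measurable_inner_normal.comp measurable_prodMk_right
  have hnext : Measurable fun r : TableBoundary p => B.flightNext r w :=
    B.measurable_flightNext.comp measurable_prodMk_right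
  have hstate : Measurable fun r : TableBoundary p => flightState r w :=
    measurable_flightState.comp measurable_prodMk_right
  rw [lintegral_arcLength
      (F := fun r => ENNReal.ofReal (inner ℝ w (r.2 : ℂ)) * f (B.flightNext r w))
      (hin.ennreal_ofReal.mul (hf.comp hnext)),
    lintegral_arcLength
      (F := fun r => ENNReal.ofReal (-inner ℝ w (r.2 : ℂ)) * f (flightState r w))
      (hin.neg.ennreal_ofReal.mul (hf.comp hstate))]
  set ρ := ‖w‖
  have hρ : 0 < ρ := norm_pos_iff.2 hw
  obtain ⟨e, hwe, he⟩ : ∃ e : ℂ, w = ρ * e ∧ ‖e‖ = 1 :=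
    ⟨direction w, (norm_mul_direction w).symm, by simp⟩
  have h1 : ∀ i, ∫⁻ t in Set.Ico 0 (2 * Real.pi * B.radius i),
      ENNReal.ofReal (inner ℝ w (arcNormal (B.radius i) t : ℂ)) *
        f (B.flightNext (i, arcNormal (B.radius i) t) w) = ENNReal.ofReal ρ *
      ∫⁻ h in Set.Ioo (-B.radius i) (B.radius i),
        f (B.flightNext (i, exitNormal e (B.radius i) h) w) := by
    intro i
    have := lintegral_exit_flux he (B.radius_pos i) hρ.le fun u => f (B.flightNext (i, u) w)
    rwa [← hwe] at this
  have h2 : ∀ i, ∫⁻ t in Set.Ico 0 (2 * Real.pi * B.radius i),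
      ENNReal.ofReal (-inner ℝ w (arcNormal (B.radius i) t : ℂ)) *
        f (flightState (i, arcNormal (B.radius i) t) w) = ENNReal.ofReal ρ *
      ∫⁻ h in Set.Ioo (-B.radius i) (B.radius i),
        f (flightState (i, entryNormal e (B.radius i) h) w) := by
    intro i
    have := lintegral_entry_flux he (B.radius_pos i) hρ.le fun u => f (flightState (i, u) w)
    rwa [← hwe] at this
  simp only [h1, h2, ENNReal.tsum_mul_left]
  congr 1
  refine tsum_setLIntegral_exit_eq_entry he (fun j => hf.comp (hstate.comp
    (measurable_const.prodMk (measurable_entryNormal e _)))) fun i h b hg hab => ?_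
  have hi : h - across e (B.center i) ∈ Set.Ioo (-B.radius i) (B.radius i) := by
    have := hab.1
    rwa [crossed, Set.mem_ofPred_eq, liftCenter_zero] at this
  have hpos := inner_exitNormal_nonneg he (B.radius_pos i) hρ.le hi
  rw [← hwe] at hpos
  rw [flightNext, next_exit hg he hρ hab rfl ((outVelocity_flightState hpos).trans hwe), ← hwe]

end

section

variable {p : ℕ} (B : ThermostattedBilliard p)

/-! ### Invariance of the equilibrium measure -/

/-- Lebesgue measure on the half-line of normal velocities. -/
abbrev speedMeasure : Measure (Set.Ici (0 : ℝ)) :=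
  (volume : Measure ℝ).comap (Subtype.val : Set.Ici (0 : ℝ) → ℝ)

instance : SFinite speedMeasure := by
  have : IsFiniteMeasureOnCompacts speedMeasure :=
    IsFiniteMeasureOnCompacts.comap' volume continuous_subtype_val
      (MeasurableEmbedding.subtype_coe measurableSet_Ici)
  have : LocallyCompactSpace (Set.Ici (0 : ℝ)) :=
    isClosed_Ici.isClosedEmbedding_subtypeVal.locallyCompactSpace
  infer_instance

instance : SFinite B.arcLength := by
  unfold arcLength
  infer_instance

/-- The two coordinates are the real and imaginary parts of the conjugate of u times w, so the map
is a rotation. -/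
theorem measurePreserving_along_across {u : ℂ} (hu : ‖u‖ = 1) :
    MeasurePreserving fun w => (along u w, across u w) := by
  have hu' : (starRingEnd ℂ) u ∈ Submonoid.unitSphere ℂ := by
    simpa [Submonoid.unitSphere] using hu
  have h := Complex.volume_preserving_equiv_real_prod.comp
    (rotation (⟨(starRingEnd ℂ) u, hu'⟩ : Circle)).measurePreserving
  convert h using 1
  ext w
  · change along u w = ((starRingEnd ℂ) u * w).re
    simp [along]
  · change across u w = ((starRingEnd ℂ) u * w).im
    simp [across]; ring

/-- The normal and tangential components are Cartesian coordinates on the half-plane of outgoing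
velocities; the flux factor vanishes on the other half-plane. -/
theorem lintegral_speed_tangential (r : TableBoundary p) {Φ : CollisionSpace p × ℝ → ENNReal}
    (hΦ : Measurable Φ) :
    ∫⁻ v, ∫⁻ s, ENNReal.ofReal (v : ℝ) * Φ ((r, v), s) ∂volume ∂speedMeasure =
      ∫⁻ w : ℂ, ENNReal.ofReal (inner ℝ w (r.2 : ℂ)) * Φ (flightState r w, across r.2 w) := by
  have hu : ‖(r.2 : ℂ)‖ = 1 := by simp
  -- The absolute value only extends the integrand to negative normal components, where the first
  -- factor is zero.
  set G : ℝ × ℝ → ENNReal := fun q =>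
    ENNReal.ofReal q.1 * Φ ((r, ⟨|q.1|, Set.mem_Ici.2 (abs_nonneg _)⟩), q.2)
  have hG : Measurable G := by
    refine measurable_fst.ennreal_ofReal.mul (hΦ.comp ?_)
    refine (measurable_const.prodMk (Measurable.subtype_mk ?_)).prodMk measurable_snd
    exact continuous_abs.measurable.comp measurable_fst
  have h1 : ∫⁻ w : ℂ, ENNReal.ofReal (inner ℝ w (r.2 : ℂ)) *
      Φ (flightState r w, across r.2 w) = ∫⁻ q, G q := by
    rw [← (measurePreserving_along_across hu).lintegral_comp hG]
    simp only [G, flightState, inner_eq_along]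
  rw [h1, Measure.volume_eq_prod, lintegral_prod _ hG.aemeasurable]
  have h2 : ∀ v : Set.Ici (0 : ℝ), ∫⁻ s, ENNReal.ofReal (v : ℝ) * Φ ((r, v), s) =
      ∫⁻ s, G ((v : ℝ), s) := by
    intro v
    have : (⟨|(v : ℝ)|, Set.mem_Ici.2 (abs_nonneg _)⟩ : Set.Ici (0 : ℝ)) = v :=
      Subtype.ext (abs_of_nonneg v.2)
    simp only [G, this]
  simp only [h2]
  rw [lintegral_subtype_comap measurableSet_Ici (fun v : ℝ => ∫⁻ s, G (v, s)),
    ← lintegral_indicator measurableSet_Ici]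
  refine lintegral_congr fun v => ?_
  by_cases hv : v ∈ Set.Ici (0 : ℝ)
  · rw [Set.indicator_of_mem hv]
  · rw [Set.indicator_of_notMem hv]
    have hv' : v ≤ 0 := (not_le.1 hv).le
    simp [G, ENNReal.ofReal_of_nonpos hv']

theorem norm_sq_eq_add_sq {u : ℂ} (hu : ‖u‖ = 1) (w : ℂ) :
    |inner ℝ w u| ^ 2 + across u w ^ 2 = ‖w‖ ^ 2 := by
  rw [sq_abs, inner_eq_along, along_sq_add_across_sq hu]

theorem perimeter_nonneg : 0 ≤ B.perimeter :=
  Finset.sum_nonneg fun i _ => by have := B.radius_pos i; positivity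

theorem measurable_normalSpeed : Measurable fun x : CollisionSpace p => (x.2 : ℝ) :=
  measurable_subtype_coe.comp measurable_snd

/-- The product of the densities of the equilibrium measure and of the tangential law. -/
theorem density_mul_lintegral_tangentialLaw {β : ℝ} (hβ : 0 < β) (x : CollisionSpace p)
    {ψ : ℝ → ENNReal} (hψ : Measurable ψ) :
    ENNReal.ofReal (2 * β / B.perimeter * (x.2 : ℝ) * Real.exp (-β * (x.2 : ℝ) ^ 2)) *
        ∫⁻ s, ψ s ∂tangentialLaw β =
      ENNReal.ofReal (2 * β / B.perimeter * √(β / Real.pi)) *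
        ∫⁻ s, ENNReal.ofReal (x.2 : ℝ) *
          (ENNReal.ofReal (Real.exp (-β * ((x.2 : ℝ) ^ 2 + s ^ 2))) * ψ s) := by
  have hperim := B.perimeter_nonneg
  have hx : (0 : ℝ) ≤ x.2 := x.2.2
  have hT : Measurable fun s : ℝ => ENNReal.ofReal (√(β / Real.pi) * Real.exp (-β * s ^ 2)) := by
    fun_prop
  have hE : Measurable fun s : ℝ => ENNReal.ofReal (Real.exp (-β * ((x.2 : ℝ) ^ 2 + s ^ 2))) := by
    fun_prop
  have hEψ : Measurable fun s => ENNReal.ofReal (x.2 : ℝ) *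
      (ENNReal.ofReal (Real.exp (-β * ((x.2 : ℝ) ^ 2 + s ^ 2))) * ψ s) :=
    (hE.mul hψ).const_mul _
  rw [tangentialLaw, lintegral_withDensity_eq_lintegral_mul _ hT hψ,
    ← lintegral_const_mul _ (hT.mul hψ), ← lintegral_const_mul _ hEψ]
  refine lintegral_congr fun s => ?_
  rw [Pi.mul_apply, ← mul_assoc, ← mul_assoc, ← mul_assoc, ← ENNReal.ofReal_mul (by positivity),
    ← ENNReal.ofReal_mul (by positivity), ← ENNReal.ofReal_mul (by positivity), mul_add,
    Real.exp_add]
  congr 2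
  ring

theorem measurable_flux {Ψ : CollisionSpace p × ℝ → ENNReal} (hΨ : Measurable Ψ) (w : ℂ) :
    Measurable fun r : TableBoundary p =>
      ENNReal.ofReal (inner ℝ w (r.2 : ℂ)) * Ψ (flightState r w, across r.2 w) := by
  have hw : Measurable fun r : TableBoundary p => (r, w) := measurable_prodMk_right
  have h1 : Measurable fun r : TableBoundary p => inner ℝ w (r.2 : ℂ) :=
    measurable_inner_normal.comp hw
  have h2 : Measurable fun r : TableBoundary p => flightState r w :=
    measurable_flightState.comp hw
  have h3 : Measurable fun r : TableBoundary p => across r.2 w :=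
    measurable_across_normal.comp hw
  exact h1.ennreal_ofReal.mul (hΨ.comp (h2.prodMk h3))

/-- The joint law of the collision state and the tangential velocity, in terms of the velocity after
the collision. -/
theorem lintegral_equilibriumMeasure_tangentialLaw {β : ℝ} (hβ : 0 < β)
    {Ψ : CollisionSpace p × ℝ → ENNReal} (hΨ : Measurable Ψ) :
    ∫⁻ x, ∫⁻ s, Ψ (x, s) ∂tangentialLaw β ∂B.equilibriumMeasure β =
      ENNReal.ofReal (2 * β / B.perimeter * √(β / Real.pi)) *
      ∫⁻ w : ℂ, ENNReal.ofReal (Real.exp (-β * ‖w‖ ^ 2)) *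
        ∫⁻ r, ENNReal.ofReal (inner ℝ w (r.2 : ℂ)) * Ψ (flightState r w, across r.2 w)
          ∂B.arcLength := by
  have hv := measurable_normalSpeed (p := p)
  have hv1 : Measurable fun z : CollisionSpace p × ℝ => (z.1.2 : ℝ) := hv.comp measurable_fst
  set Φ : CollisionSpace p × ℝ → ENNReal := fun z =>
    ENNReal.ofReal (Real.exp (-β * ((z.1.2 : ℝ) ^ 2 + z.2 ^ 2))) * Ψ z with hΦdef
  have hΦ : Measurable Φ := by
    refine (Measurable.ennreal_ofReal ?_).mul hΨ
    exact Real.measurable_exp.comp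
      (((hv1.pow_const 2).add (measurable_snd.pow_const 2)).const_mul (-β))
  have hD : Measurable fun x : CollisionSpace p => ENNReal.ofReal
      (2 * β / B.perimeter * (x.2 : ℝ) * Real.exp (-β * (x.2 : ℝ) ^ 2)) :=
    ((hv.const_mul _).mul
      (Real.measurable_exp.comp ((hv.pow_const 2).const_mul _))).ennreal_ofReal
  have := isProbabilityMeasure_tangentialLaw hβ
  have hint : Measurable fun x => ∫⁻ s, Ψ (x, s) ∂tangentialLaw β := hΨ.lintegral_prod_right'
  have hΦ' : Measurable fun x : CollisionSpace p =>
      ∫⁻ s, ENNReal.ofReal (x.2 : ℝ) * Φ (x, s) :=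
    (hv1.ennreal_ofReal.mul hΦ).lintegral_prod_right'
  have h1 : ∫⁻ x, ∫⁻ s, Ψ (x, s) ∂tangentialLaw β ∂B.equilibriumMeasure β =
      ∫⁻ x, ENNReal.ofReal (2 * β / B.perimeter * √(β / Real.pi)) *
        ∫⁻ s, ENNReal.ofReal (x.2 : ℝ) * Φ (x, s) ∂volume ∂B.arcLength.prod speedMeasure := by
    rw [equilibriumMeasure, lintegral_withDensity_eq_lintegral_mul _ hD hint]
    exact lintegral_congr fun x =>
      B.density_mul_lintegral_tangentialLaw hβ x (hΨ.comp measurable_prodMk_left)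
  rw [h1, lintegral_const_mul _ hΦ', lintegral_prod _ hΦ'.aemeasurable]
  congr 1
  have h2 : ∀ r : TableBoundary p, ∫⁻ v, ∫⁻ s, ENNReal.ofReal (v : ℝ) * Φ ((r, v), s)
      ∂volume ∂speedMeasure = ∫⁻ w : ℂ, ENNReal.ofReal (Real.exp (-β * ‖w‖ ^ 2)) *
      (ENNReal.ofReal (inner ℝ w (r.2 : ℂ)) * Ψ (flightState r w, across r.2 w)) := by
    intro r
    rw [lintegral_speed_tangential r hΦ]
    refine lintegral_congr fun w => ?_
    have := norm_sq_eq_add_sq (u := (r.2 : ℂ)) (by simp) w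
    simp only [hΦdef]
    rw [← this, mul_left_comm]
    rfl
  have hflight : Measurable fun q : TableBoundary p × ℂ =>
      Ψ (flightState q.1 q.2, across q.1.2 q.2) :=
    hΨ.comp (measurable_flightState.prodMk measurable_across_normal)
  have hin : Measurable fun q : TableBoundary p × ℂ => ENNReal.ofReal (inner ℝ q.2 (q.1.2 : ℂ)) *
      Ψ (flightState q.1 q.2, across q.1.2 q.2) :=
    measurable_inner_normal.ennreal_ofReal.mul hflight
  have hexp : Measurable fun q : TableBoundary p × ℂ =>
      ENNReal.ofReal (Real.exp (-β * ‖q.2‖ ^ 2)) := by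
    fun_prop
  have h3 : ∀ w : ℂ, ∫⁻ r, ENNReal.ofReal (Real.exp (-β * ‖w‖ ^ 2)) *
      (ENNReal.ofReal (inner ℝ w (r.2 : ℂ)) * Ψ (flightState r w, across r.2 w)) ∂B.arcLength =
      ENNReal.ofReal (Real.exp (-β * ‖w‖ ^ 2)) *
        ∫⁻ r, ENNReal.ofReal (inner ℝ w (r.2 : ℂ)) * Ψ (flightState r w, across r.2 w)
          ∂B.arcLength :=
    fun w => lintegral_const_mul _ (measurable_flux hΨ w)
  -- Tonelli puts w outside, so that the flux over the boundary can be treated at fixed velocity.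
  have h4 := lintegral_lintegral_swap (μ := B.arcLength) (ν := (volume : Measure ℂ))
    (f := fun r w => ENNReal.ofReal (Real.exp (-β * ‖w‖ ^ 2)) *
      (ENNReal.ofReal (inner ℝ w (r.2 : ℂ)) * Ψ (flightState r w, across r.2 w)))
    (hexp.mul hin).aemeasurable
  refine (lintegral_congr h2).trans (h4.trans ?_)
  exact lintegral_congr h3

theorem flightState_neg (r : TableBoundary p) (w : ℂ) : flightState r (-w) = flightState r w := by
  simp only [flightState, inner_neg_left, abs_neg]

theorem lintegral_next_equilibriumMeasure {β : ℝ} (hβ : 0 < β) {f : CollisionSpace p → ENNReal}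
    (hf : Measurable f) :
    ∫⁻ x, ∫⁻ s, f (B.next x s) ∂tangentialLaw β ∂B.equilibriumMeasure β =
      ∫⁻ x, f x ∂B.equilibriumMeasure β := by
  have := isProbabilityMeasure_tangentialLaw hβ
  -- A dummy tangential velocity is added so that both sides are covered by the same formula over w.
  have h1 : ∫⁻ x, f x ∂B.equilibriumMeasure β =
      ∫⁻ x, ∫⁻ _s, f x ∂tangentialLaw β ∂B.equilibriumMeasure β := by
    simp
  rw [h1, B.lintegral_equilibriumMeasure_tangentialLaw hβ (Ψ := fun z => f (B.next z.1 z.2))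
    (hf.comp B.measurable_next), B.lintegral_equilibriumMeasure_tangentialLaw hβ
    (Ψ := fun z => f z.1) (hf.comp measurable_fst)]
  congr 1
  -- Reversing w on the left turns the entry flux produced by the flight at -w into the exit flux at
  -- w.
  rw [← lintegral_neg_eq_self]
  refine lintegral_congr_ae ?_
  filter_upwards [compl_mem_ae_iff.2 (measure_singleton (0 : ℂ))] with w hw
  have hw' : -w ≠ 0 := neg_ne_zero.2 hw
  have h2 := lintegral_flux_flightNext (B := B) hf hw'
  simp only [flightNext, inner_neg_left, neg_neg, flightState_neg] at h2
  simp only [norm_neg, inner_neg_left, flightState_neg]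
  rw [h2]

theorem transitionKernel_invariant {β : ℝ} (hβ : 0 < β) (hB : ∀ i, B.beta i = β) :
    B.transitionKernel.Invariant (B.equilibriumMeasure β) := by
  refine Measure.ext fun A hA => ?_
  rw [Measure.bind_apply hA B.transitionKernel.measurable.aemeasurable]
  have hf : Measurable (A.indicator (1 : CollisionSpace p → ENNReal)) :=
    measurable_one.indicator hA
  rw [← lintegral_indicator_one hA, ← B.lintegral_next_equilibriumMeasure hβ hf]
  refine lintegral_congr fun x => ?_
  have hm : Measurable (B.next x) := B.measurable_next.comp measurable_prodMk_left
  change ((tangentialLaw (B.beta x.1.1)).map (B.next x)) A = _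
  rw [hB, ← lintegral_indicator_one hA, lintegral_map hf hm]

/-! ### Normalization -/

theorem arcLength_univ : B.arcLength Set.univ = ENNReal.ofReal B.perimeter := by
  rw [← lintegral_one, lintegral_arcLength (B := B) (F := fun _ => 1) measurable_const,
    tsum_fintype, perimeter, ENNReal.ofReal_sum_of_nonneg]
  · simp
  · intro i _
    have := B.radius_pos i
    positivity

/-- The density has the antiderivative -e^{-βv²}, which rises from -1 at 0 to 0 at infinity. -/
theorem lintegral_speed_density {β : ℝ} (hβ : 0 < β) :
    ∫⁻ v : Set.Ici (0 : ℝ), ENNReal.ofReal (2 * β * v * Real.exp (-β * (v : ℝ) ^ 2))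
      ∂speedMeasure = 1 := by
  rw [lintegral_subtype_comap measurableSet_Ici
    (fun v : ℝ => ENNReal.ofReal (2 * β * v * Real.exp (-β * v ^ 2))), ← restrict_Ioi_eq_restrict_Ici]
  have hint : Integrable (fun v : ℝ => 2 * β * v * Real.exp (-β * v ^ 2)) := by
    simpa only [mul_assoc] using (integrable_mul_exp_neg_mul_sq hβ).const_mul (2 * β)
  have hder : ∀ v ∈ Set.Ici (0 : ℝ), HasDerivAt (fun v : ℝ => -Real.exp (-β * v ^ 2))
      (2 * β * v * Real.exp (-β * v ^ 2)) v := by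
    intro v _
    have h := (((hasDerivAt_pow 2 v).const_mul (-β)).exp).neg
    have h1 : -(Real.exp (-β * v ^ 2) * (-β * ((2 : ℕ) * v ^ (2 - 1)))) =
        2 * β * v * Real.exp (-β * v ^ 2) := by
      push_cast
      ring
    exact h1 ▸ h
  have hlim : Filter.Tendsto (fun v : ℝ => -Real.exp (-β * v ^ 2)) Filter.atTop (nhds 0) := by
    rw [← neg_zero]
    refine (Real.tendsto_exp_atBot.comp ?_).neg
    exact (Filter.tendsto_pow_atTop two_ne_zero).const_mul_atTop_of_neg (neg_lt_zero.2 hβ)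
  rw [← ofReal_integral_eq_lintegral_ofReal hint.integrableOn, integral_Ioi_of_hasDerivAt_of_tendsto'
    hder hint.integrableOn hlim]
  · simp
  · filter_upwards [ae_restrict_mem measurableSet_Ioi] with v hv
    have : (0 : ℝ) < v := hv
    simp only [Pi.zero_apply]
    positivity

/-- Bounded horizon fails on a table without obstacles. This makes the perimeter positive and the
common β the temperature of some obstacle, hence positive. -/
theorem nonempty_obstacles (B : ThermostattedBilliard p) : Nonempty (Fin p) := by
  obtain ⟨L, hL⟩ := B.bounded_horizon
  obtain ⟨-, -, a, -⟩ := hL 0 1 (by simp)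
  exact ⟨a.1⟩

theorem perimeter_pos : 0 < B.perimeter := by
  have := B.nonempty_obstacles
  exact Finset.sum_pos (fun i _ => by have := B.radius_pos i; positivity) Finset.univ_nonempty

theorem isProbabilityMeasure_equilibriumMeasure {β : ℝ} (hβ : 0 < β) :
    IsProbabilityMeasure (B.equilibriumMeasure β) := by
  constructor
  have hL := B.perimeter_pos
  have hv := measurable_normalSpeed (p := p)
  have hd : Measurable fun x : CollisionSpace p =>
      ENNReal.ofReal (2 * β * (x.2 : ℝ) * Real.exp (-β * (x.2 : ℝ) ^ 2)) :=
    ((hv.const_mul _).mul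
      (Real.measurable_exp.comp ((hv.pow_const 2).const_mul _))).ennreal_ofReal
  have h1 : ∀ x : CollisionSpace p, ENNReal.ofReal
      (2 * β / B.perimeter * (x.2 : ℝ) * Real.exp (-β * (x.2 : ℝ) ^ 2)) =
      ENNReal.ofReal B.perimeter⁻¹ *
        ENNReal.ofReal (2 * β * (x.2 : ℝ) * Real.exp (-β * (x.2 : ℝ) ^ 2)) := by
    intro x
    rw [← ENNReal.ofReal_mul (by positivity)]
    congr 1
    ring
  rw [equilibriumMeasure, withDensity_apply _ MeasurableSet.univ, Measure.restrict_univ]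
  simp only [h1]
  rw [lintegral_const_mul _ hd, lintegral_prod _ hd.aemeasurable]
  simp only [lintegral_speed_density hβ]
  rw [lintegral_const, one_mul, arcLength_univ, ← ENNReal.ofReal_mul (by positivity),
    inv_mul_cancel₀ hL.ne', ENNReal.ofReal_one]

end

end ThermostattedBilliard

end

theorem mainTheorem7 {p : ℕ} (B : ThermostattedBilliard p) (β : ℝ) (hβ : ∀ i, B.beta i = β) :
    IsProbabilityMeasure (B.equilibriumMeasure β) ∧
      B.transitionKernel.Invariant (B.equilibriumMeasure β) := by
  obtain ⟨i⟩ := B.nonempty_obstacles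
  have hpos : 0 < β := hβ i ▸ B.beta_pos i
  exact ⟨B.isProbabilityMeasure_equilibriumMeasure hpos, B.transitionKernel_invariant hpos hβ⟩
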